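/- Let $\varphi_1,\dots,\varphi_n\colon\mathbb{R}\to\mathbb{R}$ be finitely many contracting similarities, that is, for each $a$ there is $r_a\in(0,1)$ with $|\varphi_a(x)-\varphi_a(y)|=r_a|x-y|$ for all $x,y\in\mathbb{R}$, and suppose that they do not all share a common fixed point. Let $p_1,\dots,p_n>0$ with $\sum_{a=1}^n p_a=1$, and let $\mu$ be the corresponding self-similar measure, that is, the Borel probability measure on $\mathbb{R}$ satisfying $\mu=\sum_{a=1}^n p_a\,\varphi_a\mu$, where $\varphi_a\mu$ is the pushforward of $\mu$ under $\varphi_a$. Suppose that $\operatorname{supp}\mu\subseteq[0,1]$. Let $F\colon[0,1]\to\mathbb{R}$ be real analytic (for every $x_0\in[0,1]$ there are $\epsilon>0$ and a power series about $x_0$ that converges to $F(x)$ for all $x\in(x_0-\epsilon,x_0+\epsilon)\cap[0,1]$) and not affine (there are no $\alpha,\beta\in\mathbb{R}$ with $F(x)=\alpha x+\beta$ for all $x\in[0,1]$). Then the pushforward measure $F\mu$ has polynomial Fourier decay: there exist $C,\eta>0$ such that \[ \left|\int_{[0,1]} e^{-2\pi i\xi F(x)}\,d\mu(x)\right|\le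 C|\xi|^{-\eta}\qquad\text{for all }\xi\in\mathbb{R}\setminus\{0\}. \] -/

import Mathlib

open MeasureTheory Set

noncomputable section

namespace SelfSimilarDecay

/-- A contracting similarity of the line: it multiplies all distances by one `r ∈ (0, 1)`.
Orientation-reversing maps are allowed. -/
def IsContractingSimilarity (φ : ℝ → ℝ) : Prop :=
  ∃ r : ℝ, 0 < r ∧ r < 1 ∧ ∀ x y : ℝ, |φ x - φ y| = r * |x - y|

/-- `μ` is a Borel probability measure with `μ = ∑ a, p a • φ_a μ`. -/
def IsStationaryMeasure {A : Type*} [Fintype A] (φ : A → ℝ → ℝ) (p : A → ℝ)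
    (μ : Measure ℝ) : Prop :=
  IsProbabilityMeasure μ ∧ μ = ∑ a, ENNReal.ofReal (p a) • μ.map (φ a)

/-- `μ` is a self-similar measure: the stationary measure of a finite family of contracting
similarities without a common fixed point, for strictly positive weights summing to one. -/
def IsSelfSimilarMeasure (μ : Measure ℝ) : Prop :=
  ∃ (n : ℕ) (φ : Fin n → ℝ → ℝ) (p : Fin n → ℝ),
    (∀ a, IsContractingSimilarity (φ a)) ∧
    (¬ ∃ x : ℝ, ∀ a, φ a x = x) ∧
    (∀ a, 0 < p a) ∧ ∑ a, p a = 1 ∧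
    IsStationaryMeasure φ p μ

/-- The Fourier transform `ξ ↦ ∫ exp(-2πiξx) dν(x)` of a finite measure `ν`. -/
def fourierTransform (ν : Measure ℝ) (ξ : ℝ) : ℂ :=
  ∫ x : ℝ, Complex.exp (-2 * (Real.pi : ℂ) * Complex.I * (ξ : ℂ) * (x : ℂ)) ∂ν

def HasPolynomialFourierDecay (ν : Measure ℝ) : Prop :=
  ∃ C η : ℝ, 0 < C ∧ 0 < η ∧
    ∀ ξ : ℝ, ξ ≠ 0 → ‖fourierTransform ν ξ‖ ≤ C * |ξ| ^ (-η)

def IsAffineOn (F : ℝ → ℝ) (s : Set ℝ) : Prop :=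
  ∃ a b : ℝ, ∀ x ∈ s, F x = a * x + b

/-- The pushforward `μ.map F` below is a genuine pushforward (not the junk value `0`): a function
that is analytic on `[0, 1]` is almost everywhere measurable for a measure supported there. -/
theorem aemeasurable_of_analyticOn {μ : Measure ℝ} (hμ : μ.support ⊆ Icc 0 1)
    {F : ℝ → ℝ} (hF : AnalyticOn ℝ F (Icc 0 1)) : AEMeasurable F μ := by
  have h : μ.restrict (Icc 0 1) = μ := by
    apply Measure.restrict_eq_self_of_ae_mem
    filter_upwards [Measure.support_mem_ae (μ := μ)] with x hx using hμ hx
  rw [← h]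
  exact hF.continuousOn.aemeasurable measurableSet_Icc

end SelfSimilarDecay

end

noncomputable section

namespace SelfSimilarDecay

/-! Linearize the phase on small pieces of `μ`. With `|ξ| = Z^3` and pieces of size about `Z^(-2)`,
the quadratic error is of order `1/Z`, and a piece of signed ratio `σ` contributes the Fourier
transform of `μ` at `ξ * |σ| * F'`, a frequency of size at most a constant times `Z`. That transform
need not decay at every frequency, but two facts together suffice.

Large values are sparse (`exists_cover_fourierTransform`): at most `T^ε` balls of bounded radius
cover the frequencies up to `T` at which the transform exceeds `T^(-δ)`. This is an Erdős–Kahane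
argument. The words `ab` and `ba` have the same ratio, so their terms in the Fourier recursion
differ only by a phase, and they interfere destructively unless `ξ * τ` is near an integer; `τ ≠ 0`
when the fixed points differ. A near-integer frequency is determined by its contraction, so
branching is paid for by gains. Ratios ignore the order of letters, hence words of length `m` have
only polynomially many of them; this makes `ε` arbitrary.

The derivative avoids few values: `μ` is Hölder regular (`exists_frostman`), and `F''` has only
zeros of finite order because `F` is analytic and not affine, so `F'` lies within `h` of a given
value on mass `O(h^s)` (`hasSublevelBound_deriv`).

A bad piece forces `F'` to be within `O(1/Z)` of some `e / (ξ * ratio)` with `e` exceptional. There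
are at most `O(Z^(s/4))` ratios and `O(Z^(s/4))` values `e`, so bad pieces have mass `O(Z^(-s/2))`
(`exists_decay_of_sublevel`). -/

/-! ### The Erdős–Kahane counting argument. -/

lemma exists_int_mul_near {c z : ℝ} {B : ℕ} (hc : 0 < c) (hz : |z| ≤ c * B) :
    ∃ l ∈ Finset.Icc (-(B : ℤ)) B, |z - l * c| ≤ c := by
  have hz' := abs_le.1 hz
  refine ⟨⌊z / c⌋, ?_, ?_⟩
  · rw [Finset.mem_Icc]
    constructor
    · rw [Int.le_floor, le_div_iff₀ hc]
      push_cast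
      linarith
    · have h1 : (⌊z / c⌋ : ℝ) ≤ B := by
        refine (Int.floor_le _).trans ?_
        rw [div_le_iff₀ hc]
        linarith
      exact_mod_cast h1
  · have h1 := Int.floor_le (z / c)
    have h2 := Int.lt_floor_add_one (z / c)
    rw [le_div_iff₀ hc] at h1
    rw [div_lt_iff₀ hc] at h2
    rw [abs_le]
    constructor <;> linarith

/-- The Erdős–Kahane counting argument: if `h` does not decrease along a suitable contraction by a
ratio from the finite set `R`, and increases by a definite factor at points that are not close to
an integer, then the large values of `h` are taken near few points. -/
theorem exists_cover_of_gain {h : ℝ → ℝ} {R : Finset ℝ} {lo hi c q : ℝ} {B : ℕ}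
    (hlo : 0 < lo) (hR : ∀ ρ ∈ R, lo ≤ ρ ∧ ρ ≤ hi) (hhi : 0 < hi)
    (hc : 0 < c) (hclo : c * (1 + 1 / lo) < 1 / 2) (hq : 0 < q) (hq1 : q < 1)
    (hB : 1 / lo ≤ B) (h1 : ∀ x, h x ≤ 1)
    (hstep : ∀ x, ∃ ρ ∈ R, h x ≤ h (ρ * x) ∧ (c ≤ |x - round x| → h x ≤ q * h (ρ * x))) :
    ∀ N j : ℕ, ∃ Y : Finset ℝ, Y.card ≤ (2 * R.card) ^ N * (2 * B + 1) ^ j ∧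
      ∀ x, |x| ≤ c / hi ^ N → q ^ j ≤ h x → ∃ y ∈ Y, |x - y| ≤ c := by
  intro N
  induction N with
  | zero =>
    intro j
    refine ⟨{0}, ?_, fun x hx _ => ⟨0, by simp, by simpa using hx⟩⟩
    simpa using Nat.one_le_pow j (2 * B + 1) (by omega)
  | succ N ih =>
    have key : ∀ x ρ y : ℝ, ρ ∈ R → |ρ * x - y| ≤ c → |x - y / ρ| ≤ c * (1 / lo) := by
      intro x ρ y hρ hy
      have hρ0 : 0 < ρ := hlo.trans_le (hR ρ hρ).1
      have : x - y / ρ = (ρ * x - y) / ρ := by field_simp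
      rw [this, abs_div, abs_of_pos hρ0, div_le_iff₀ hρ0]
      refine hy.trans ?_
      have : 1 ≤ 1 / lo * ρ := by
        rw [one_div, ← div_eq_inv_mul, le_div_iff₀ hlo]
        linarith [(hR ρ hρ).1]
      nlinarith
    have shrink : ∀ x ρ : ℝ, ρ ∈ R → |x| ≤ c / hi ^ (N + 1) → |ρ * x| ≤ c / hi ^ N := by
      intro x ρ hρ hx
      have hρ0 : 0 < ρ := hlo.trans_le (hR ρ hρ).1
      rw [abs_mul, abs_of_pos hρ0]
      calc ρ * |x| ≤ hi * (c / hi ^ (N + 1)) :=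
            mul_le_mul (hR ρ hρ).2 hx (abs_nonneg _) hhi.le
        _ = c / hi ^ N := by rw [pow_succ]; field_simp
    -- Since `c * (1 + 1 / lo) < 1 / 2`, the integer near `x` is also the nearest one to `y / ρ`: no
    -- new choice arises beyond `ρ`.
    have good : ∀ x ρ y : ℝ, ρ ∈ R → |ρ * x - y| ≤ c → |x - round x| < c →
        |x - (round (y / ρ) : ℤ)| ≤ c := by
      intro x ρ y hρ hy hx
      have h2 := key x ρ y hρ hy
      have h3 : round (y / ρ) = round x := by
        rw [round_eq, Int.floor_eq_iff]
        have h4 := abs_le.1 h2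
        have h5 := abs_lt.1 hx
        constructor <;> nlinarith
      rw [h3]
      exact hx.le
    intro j
    cases j with
    | zero =>
      obtain ⟨Y, hYc, hY⟩ := ih 0
      refine ⟨(R ×ˢ Y).image fun z => ((round (z.2 / z.1) : ℤ) : ℝ), ?_, ?_⟩
      · refine Finset.card_image_le.trans ?_
        rw [Finset.card_product]
        simp only [pow_zero, mul_one] at hYc ⊢
        rw [pow_succ]
        nlinarith [Nat.zero_le (R.card), Nat.zero_le ((2 * R.card) ^ N)]
      · intro x hx hhx
        obtain ⟨ρ, hρ, hle, hgain⟩ := hstep x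
        -- With `j = 0` no gain is affordable: it would give `h x ≤ q < 1`.
        have hgood : |x - round x| < c := by
          by_contra hcon
          have := hgain (not_lt.1 hcon)
          have := h1 (ρ * x)
          rw [pow_zero] at hhx
          nlinarith
        obtain ⟨y, hy, hyx⟩ := hY (ρ * x) (shrink x ρ hρ hx) (hhx.trans hle)
        exact ⟨_, Finset.mem_image.2 ⟨(ρ, y), by simp [hρ, hy], rfl⟩, good x ρ y hρ hyx hgood⟩
    | succ j =>
      obtain ⟨Y, hYc, hY⟩ := ih (j + 1)
      obtain ⟨Z, hZc, hZ⟩ := ih j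
      -- The two sets serve points near and far from the integers; having two of them is the factor
      -- 2 in `2 * R.card`.
      refine ⟨((R ×ˢ Y).image fun z => ((round (z.2 / z.1) : ℤ) : ℝ)) ∪
        ((R ×ˢ Z) ×ˢ Finset.Icc (-(B : ℤ)) B).image fun z => z.1.2 / z.1.1 + z.2 * c, ?_, ?_⟩
      · refine (Finset.card_union_le _ _).trans ?_
        refine (add_le_add Finset.card_image_le Finset.card_image_le).trans ?_
        rw [Finset.card_product, Finset.card_product, Finset.card_product, Int.card_Icc]
        have hB' : ((B : ℤ) + 1 - -(B : ℤ)).toNat = 2 * B + 1 := by omega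
        rw [hB']
        calc R.card * Y.card + R.card * Z.card * (2 * B + 1)
            ≤ R.card * ((2 * R.card) ^ N * (2 * B + 1) ^ (j + 1)) +
              R.card * ((2 * R.card) ^ N * (2 * B + 1) ^ j) * (2 * B + 1) := by gcongr
          _ = (2 * R.card) ^ (N + 1) * (2 * B + 1) ^ (j + 1) := by ring
      · intro x hx hhx
        obtain ⟨ρ, hρ, hle, hgain⟩ := hstep x
        by_cases hgood : |x - round x| < c
        · obtain ⟨y, hy, hyx⟩ := hY (ρ * x) (shrink x ρ hρ hx) (hhx.trans hle)
          exact ⟨_, Finset.mem_union_left _ (Finset.mem_image.2 ⟨(ρ, y), by simp [hρ, hy], rfl⟩),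
            good x ρ y hρ hyx hgood⟩
        -- A gain lowers `j` by one; its price is a grid of `2 * B + 1` points of step `c` around `y
        -- / ρ`.
        · have hg := hgain (not_lt.1 hgood)
          have hj : q ^ j ≤ h (ρ * x) := by
            rw [pow_succ] at hhx
            have : q * q ^ j ≤ q * h (ρ * x) := by linarith
            exact le_of_mul_le_mul_left this hq
          obtain ⟨y, hy, hyx⟩ := hZ (ρ * x) (shrink x ρ hρ hx) hj
          have h2 : |x - y / ρ| ≤ c * B :=
            (key x ρ y hρ hyx).trans (mul_le_mul_of_nonneg_left hB hc.le)
          obtain ⟨l, hl, hlx⟩ := exists_int_mul_near hc h2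
          refine ⟨_, Finset.mem_union_right _
            (Finset.mem_image.2 ⟨((ρ, y), l), by simpa [hρ, hy] using hl, rfl⟩), ?_⟩
          rw [← sub_sub]
          exact hlx

/-! ### Affine systems and their stationary measures. -/

/-- A finite system of contracting affine maps `x ↦ r a * x + t a` of the line with positive
weights `p a`. -/
structure AffineIFS (n : ℕ) where
  r : Fin n → ℝ
  t : Fin n → ℝ
  p : Fin n → ℝ
  lo : ℝ
  hi : ℝ
  lo_pos : 0 < lo
  hi_lt_one : hi < 1
  lo_le : ∀ a, lo ≤ |r a|
  le_hi : ∀ a, |r a| ≤ hi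
  p_pos : ∀ a, 0 < p a
  p_sum : ∑ a, p a = 1

namespace AffineIFS

variable {n : ℕ} (S : AffineIFS n)

def toMap (a : Fin n) (x : ℝ) : ℝ := S.r a * x + S.t a

lemma measurable_toMap (a : Fin n) : Measurable (S.toMap a) := by
  unfold toMap; fun_prop

lemma nonempty (S : AffineIFS n) : Nonempty (Fin n) := by
  by_contra h
  rw [not_nonempty_iff] at h
  simpa using S.p_sum

lemma lo_le_hi : S.lo ≤ S.hi := by
  obtain ⟨a⟩ := S.nonempty
  exact (S.lo_le a).trans (S.le_hi a)

lemma hi_pos : 0 < S.hi := S.lo_pos.trans_le S.lo_le_hi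

lemma abs_r_pos (a : Fin n) : 0 < |S.r a| := S.lo_pos.trans_le (S.lo_le a)

lemma r_ne (a : Fin n) : S.r a ≠ 0 := abs_pos.1 (S.abs_r_pos a)

lemma abs_r_lt_one (a : Fin n) : |S.r a| < 1 := (S.le_hi a).trans_lt S.hi_lt_one

lemma one_sub_r_ne (a : Fin n) : 1 - S.r a ≠ 0 := by
  have := (abs_lt.1 (S.abs_r_lt_one a)).2
  linarith

def fixedPoint (a : Fin n) : ℝ := S.t a / (1 - S.r a)

lemma toMap_iterate (a : Fin n) (k : ℕ) (x : ℝ) :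
    (S.toMap a)^[k] x = S.fixedPoint a + S.r a ^ k * (x - S.fixedPoint a) := by
  induction k with
  | zero => simp
  | succ k ih =>
    rw [Function.iterate_succ_apply', ih, toMap, pow_succ, fixedPoint]
    have := S.one_sub_r_ne a
    field_simp
    ring

lemma exists_le_of_sum_le {g : Fin n → ℝ} {x : ℝ} (h : x ≤ ∑ a, S.p a * g a) :
    ∃ a, x ≤ g a := by
  by_contra! hcon
  have := S.nonempty
  have : ∑ a, S.p a * g a < ∑ a, S.p a * x :=
    Finset.sum_lt_sum_of_nonempty Finset.univ_nonempty
      fun a _ => mul_lt_mul_of_pos_left (hcon a) (S.p_pos a)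
  rw [← Finset.sum_mul, S.p_sum, one_mul] at this
  linarith

end AffineIFS

/-- `μ` is a probability measure carried by `[0, 1]` which is stationary for `S`. -/
structure IsCarriedStationary {n : ℕ} (S : AffineIFS n) (μ : Measure ℝ) : Prop where
  prob : IsProbabilityMeasure μ
  eq : μ = ∑ a, ENNReal.ofReal (S.p a) • μ.map (S.toMap a)
  supp : μ.support ⊆ Icc 0 1

namespace IsCarriedStationary

variable {n : ℕ} {S : AffineIFS n} {μ : Measure ℝ}

lemma integral_eq (hμ : IsCarriedStationary S μ) {f : ℝ → ℂ} (hf : Measurable f) {C : ℝ}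
    (hC : ∀ x, ‖f x‖ ≤ C) : ∫ x, f x ∂μ = ∑ a, (S.p a : ℂ) * ∫ x, f (S.toMap a x) ∂μ := by
  have := hμ.prob
  have hint : ∀ a, Integrable f (μ.map (S.toMap a)) := fun a => by
    have : IsProbabilityMeasure (μ.map (S.toMap a)) :=
      Measure.isProbabilityMeasure_map (S.measurable_toMap a).aemeasurable
    exact Integrable.of_bound hf.aestronglyMeasurable C (Filter.Eventually.of_forall hC)
  conv_lhs => rw [hμ.eq]
  rw [integral_finsetSum_measure fun a _ => (hint a).smul_measure ENNReal.ofReal_ne_top]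
  refine Finset.sum_congr rfl fun a _ => ?_
  rw [integral_smul_measure, ENNReal.toReal_ofReal (S.p_pos a).le,
    integral_map (S.measurable_toMap a).aemeasurable hf.aestronglyMeasurable]
  rfl

lemma measureReal_eq (hμ : IsCarriedStationary S μ) {E : Set ℝ} (hE : MeasurableSet E) :
    μ.real E = ∑ a, S.p a * μ.real (S.toMap a ⁻¹' E) := by
  have := hμ.prob
  have h : μ E = ∑ a, ENNReal.ofReal (S.p a) * μ (S.toMap a ⁻¹' E) := by
    conv_lhs => rw [hμ.eq]
    rw [Measure.finsetSum_apply]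
    refine Finset.sum_congr rfl fun a _ => ?_
    rw [Measure.smul_apply, Measure.map_apply (S.measurable_toMap a) hE, smul_eq_mul]
  rw [Measure.real, h, ENNReal.toReal_sum fun a _ =>
    ENNReal.mul_ne_top ENNReal.ofReal_ne_top (measure_ne_top _ _)]
  refine Finset.sum_congr rfl fun a _ => ?_
  rw [ENNReal.toReal_mul, ENNReal.toReal_ofReal (S.p_pos a).le, Measure.real]

lemma measureReal_eq_zero {E : Set ℝ} (hE : ∀ x ∈ μ.support, x ∉ E) : μ.real E = 0 := by
  have h : μ E = 0 := measure_mono_null (fun x hx hx' => hE x hx' hx)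
    (mem_ae_iff.1 (Measure.support_mem_ae (μ := μ)))
  simp [Measure.real, h]

lemma measureReal_eq_one (hμ : IsCarriedStationary S μ) {E : Set ℝ} (hE : μ.support ⊆ E) :
    μ.real E = 1 := by
  have := hμ.prob
  have h : μ E = 1 := 
    (measure_congr (Filter.eventuallyEq_univ.2
      (Filter.mem_of_superset (Measure.support_mem_ae (μ := μ)) hE))).trans measure_univ
  simp [Measure.real, h]

lemma support_nonempty (hμ : IsCarriedStationary S μ) : μ.support.Nonempty := by
  by_contra h
  have h1 := hμ.measureReal_eq_one (E := ∅) (by rw [not_nonempty_iff_eq_empty.1 h])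
  simp at h1

lemma mapsTo_support (hμ : IsCarriedStationary S μ) (a : Fin n) :
    MapsTo (S.toMap a) μ.support μ.support := by
  have := hμ.prob
  intro x hx
  rw [Measure.mem_support_iff_forall] at hx ⊢
  intro U hU
  obtain ⟨V, hVU, hVo, hxV⟩ := mem_nhds_iff.1 hU
  refine lt_of_lt_of_le ?_ (measure_mono hVU)
  have hcont : Continuous (S.toMap a) := by unfold AffineIFS.toMap; fun_prop
  have h1 := hx (S.toMap a ⁻¹' V) ((hVo.preimage hcont).mem_nhds hxV)
  have h2 := hμ.measureReal_eq hVo.measurableSet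
  have h3 : 0 < μ.real V := by
    rw [h2]
    refine Finset.sum_pos' (fun b _ => mul_nonneg (S.p_pos b).le measureReal_nonneg)
      ⟨a, Finset.mem_univ _, mul_pos (S.p_pos a) ?_⟩
    exact ENNReal.toReal_pos h1.ne' (measure_ne_top _ _)
  exact pos_iff_ne_zero.2 fun h0 => by simp [Measure.real, h0] at h3

end IsCarriedStationary

/-! ### Characters and elementary Fourier bounds. -/

/-- The character `x ↦ exp(-2πix)` in the normalization of `fourierTransform`. -/
def expNeg (x : ℝ) : ℂ := Complex.exp (-2 * (Real.pi : ℂ) * Complex.I * (x : ℂ))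

lemma expNeg_eq (x : ℝ) : expNeg x = Complex.exp (((-2 * Real.pi * x : ℝ) : ℂ) * Complex.I) := by
  rw [expNeg]; congr 1; push_cast; ring

lemma norm_expNeg (x : ℝ) : ‖expNeg x‖ = 1 := by
  rw [expNeg_eq, Complex.norm_exp_ofReal_mul_I]

lemma expNeg_add (x y : ℝ) : expNeg (x + y) = expNeg x * expNeg y := by
  rw [expNeg, expNeg, expNeg, ← Complex.exp_add]; congr 1; push_cast; ring

lemma continuous_expNeg : Continuous expNeg := by
  unfold expNeg; fun_prop

lemma norm_expNeg_sub_le (x y : ℝ) : ‖expNeg x - expNeg y‖ ≤ 2 * Real.pi * |x - y| := by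
  have h : expNeg x - expNeg y = expNeg y * (expNeg (x - y) - 1) := by
    rw [mul_sub, ← expNeg_add]; simp
  rw [h, norm_mul, norm_expNeg, one_mul, expNeg_eq, mul_comm _ Complex.I]
  refine (Real.norm_exp_I_mul_ofReal_sub_one_le).trans ?_
  rw [Real.norm_eq_abs, abs_mul, abs_mul, abs_neg, abs_two, abs_of_pos Real.pi_pos]

lemma norm_expNeg_add_expNeg (x y : ℝ) :
    ‖expNeg x + expNeg y‖ = 2 * |Real.cos (Real.pi * (x - y))| := by
  have h : expNeg x + expNeg y = expNeg ((x + y) / 2) *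
      ((2 * Real.cos (Real.pi * (x - y)) : ℝ) : ℂ) := by
    have h1 : expNeg x = expNeg ((x + y) / 2) * expNeg ((x - y) / 2) := by
      rw [← expNeg_add]; congr 1; ring
    have h2 : expNeg y = expNeg ((x + y) / 2) * expNeg (-((x - y) / 2)) := by
      rw [← expNeg_add]; congr 1; ring
    rw [h1, h2, ← mul_add]
    congr 1
    push_cast
    rw [Complex.two_cos, expNeg_eq, expNeg_eq, add_comm]
    congr 2 <;> push_cast <;> ring
  rw [h, norm_mul, norm_expNeg, one_mul, Complex.norm_real, Real.norm_eq_abs, abs_mul, abs_two]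

lemma abs_cos_pi_mul_le {c x : ℝ} (hc : 0 ≤ c) (hx : c ≤ |x - round x|) :
    |Real.cos (Real.pi * x)| ≤ Real.cos (Real.pi * c) := by
  have hπ := Real.pi_pos
  have h1 : |Real.cos (Real.pi * x)| = |Real.cos (Real.pi * |x - round x|)| := by
    have : Real.pi * x = Real.pi * (x - round x) + round x * Real.pi := by ring
    rw [this, Real.cos_add_int_mul_pi, abs_mul, ← Real.cos_abs (Real.pi * (x - round x)), abs_mul,
      abs_of_pos hπ]
    simp
  have h2 : |x - round x| ≤ 1 / 2 := abs_sub_round x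
  have h3 : 0 ≤ |x - round x| := abs_nonneg _
  rw [h1, abs_of_nonneg]
  · exact Real.cos_le_cos_of_nonneg_of_le_pi (by positivity) (by nlinarith) (by gcongr)
  · exact Real.cos_nonneg_of_mem_Icc ⟨by nlinarith, by nlinarith⟩

lemma fourierTransform_eq (μ : Measure ℝ) (ξ : ℝ) :
    fourierTransform μ ξ = ∫ x, expNeg (ξ * x) ∂μ := by
  simp only [fourierTransform, expNeg, Complex.ofReal_mul, mul_assoc]

lemma norm_fourierTransform_le_one (μ : Measure ℝ) [IsProbabilityMeasure μ] (ξ : ℝ) :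
    ‖fourierTransform μ ξ‖ ≤ 1 := by
  rw [fourierTransform_eq]
  refine (norm_integral_le_integral_norm _).trans ?_
  simp [norm_expNeg]

lemma norm_fourierTransform_neg (μ : Measure ℝ) (ξ : ℝ) :
    ‖fourierTransform μ (-ξ)‖ = ‖fourierTransform μ ξ‖ := by
  have : fourierTransform μ (-ξ) = (starRingEnd ℂ) (fourierTransform μ ξ) := by
    rw [fourierTransform_eq, fourierTransform_eq, ← integral_conj]
    refine integral_congr_ae (Filter.Eventually.of_forall fun x => ?_)
    simp only [expNeg_eq, ← Complex.exp_conj, map_mul, Complex.conj_I, Complex.conj_ofReal]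
    congr 1; push_cast; ring
  rw [this, RCLike.norm_conj]

lemma norm_fourierTransform_of_abs_eq (μ : Measure ℝ) {ξ η : ℝ} (h : |ξ| = |η|) :
    ‖fourierTransform μ ξ‖ = ‖fourierTransform μ η‖ := by
  rcases abs_eq_abs.1 h with h | h
  · rw [h]
  · rw [h, norm_fourierTransform_neg]

/-! ### The Fourier recursion and the gain from `ab` and `ba`. -/

namespace IsCarriedStationary

variable {n : ℕ} {S : AffineIFS n} {μ : Measure ℝ}

lemma fourierTransform_eq_sum (hμ : IsCarriedStationary S μ) (ξ : ℝ) :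
    fourierTransform μ ξ =
      ∑ a, (S.p a : ℂ) * (expNeg (ξ * S.t a) * fourierTransform μ (S.r a * ξ)) := by
  rw [fourierTransform_eq, hμ.integral_eq (f := fun x => expNeg (ξ * x)) (C := 1)
    (continuous_expNeg.comp (continuous_const.mul continuous_id)).measurable
    fun x => (norm_expNeg _).le]
  refine Finset.sum_congr rfl fun a _ => ?_
  rw [fourierTransform_eq]
  have h : ∀ x, expNeg (ξ * S.toMap a x) = expNeg (ξ * S.t a) * expNeg (S.r a * ξ * x) :=
    fun x => by
      rw [← expNeg_add, AffineIFS.toMap]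
      congr 1
      ring
  simp only [h, integral_const_mul]

/-- The transform is an average of its contracted values up to unimodular factors, so some term is
at least as large. Absolute values of ratios suffice because its modulus is even. -/
lemma exists_norm_fourierTransform_le (hμ : IsCarriedStationary S μ) (ξ : ℝ) :
    ∃ a, ‖fourierTransform μ ξ‖ ≤ ‖fourierTransform μ (|S.r a| * ξ)‖ := by
  refine S.exists_le_of_sum_le ?_
  rw [hμ.fourierTransform_eq_sum]
  refine (norm_sum_le _ _).trans (Finset.sum_le_sum fun a _ => le_of_eq ?_)
  rw [norm_mul, norm_mul, norm_expNeg, one_mul, Complex.norm_real, Real.norm_eq_abs,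
    abs_of_pos (S.p_pos a)]
  congr 1
  exact norm_fourierTransform_of_abs_eq μ (by simp [abs_mul])

lemma fourierTransform_eq_sum_sum (hμ : IsCarriedStationary S μ) (ξ : ℝ) :
    fourierTransform μ ξ = ∑ z : Fin n × Fin n, ((S.p z.1 * S.p z.2 : ℝ) : ℂ) *
      (expNeg (ξ * (S.t z.1 + S.r z.1 * S.t z.2)) *
        fourierTransform μ (S.r z.1 * S.r z.2 * ξ)) := by
  rw [hμ.fourierTransform_eq_sum, Fintype.sum_prod_type]
  refine Finset.sum_congr rfl fun a _ => ?_
  rw [hμ.fourierTransform_eq_sum, Finset.mul_sum, Finset.mul_sum]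
  refine Finset.sum_congr rfl fun b _ => ?_
  rw [mul_add, expNeg_add, show S.r b * (S.r a * ξ) = S.r a * S.r b * ξ by ring,
    show S.r a * ξ * S.t b = ξ * (S.r a * S.t b) by ring]
  push_cast
  ring

/-- Words `ab` and `ba` have equal contraction ratios; the interference of their translation parts
gives a gain away from the integers. -/
lemma exists_norm_fourierTransform_le_of_two (hμ : IsCarriedStationary S μ) {a b : Fin n}
    (hab : a ≠ b) (ξ : ℝ) : ∃ c d, ‖fourierTransform μ ξ‖ ≤
      (1 - 2 * (S.p a * S.p b) * (1 - |Real.cos (Real.pi *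
        (ξ * (S.t a + S.r a * S.t b - (S.t b + S.r b * S.t a))))|)) *
      ‖fourierTransform μ (|S.r c| * |S.r d| * ξ)‖ := by
  have hne := S.nonempty
  -- The maximizing pair need not be `(a, b)`; its value bounds every term, the interfering ones
  -- included.
  obtain ⟨z, -, hz⟩ := Finset.exists_max_image (Finset.univ : Finset (Fin n × Fin n))
    (fun z => ‖fourierTransform μ (S.r z.1 * S.r z.2 * ξ)‖) Finset.univ_nonempty
  refine ⟨z.1, z.2, ?_⟩
  have hzz : ‖fourierTransform μ (|S.r z.1| * |S.r z.2| * ξ)‖ =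
      ‖fourierTransform μ (S.r z.1 * S.r z.2 * ξ)‖ :=
    norm_fourierTransform_of_abs_eq μ (by simp [abs_mul])
  rw [hzz]
  set M := ‖fourierTransform μ (S.r z.1 * S.r z.2 * ξ)‖
  have hM : 0 ≤ M := norm_nonneg _
  set G : Fin n × Fin n → ℂ := fun z => ((S.p z.1 * S.p z.2 : ℝ) : ℂ) *
      (expNeg (ξ * (S.t z.1 + S.r z.1 * S.t z.2)) * fourierTransform μ (S.r z.1 * S.r z.2 * ξ))
    with hG
  have hpair : ((a, b) : Fin n × Fin n) ≠ (b, a) := by simp [hab]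
  have hsub : ({(a, b), (b, a)} : Finset (Fin n × Fin n)) ⊆ Finset.univ := Finset.subset_univ _
  have hnorm : ∀ w, ‖G w‖ ≤ S.p w.1 * S.p w.2 * M := fun w => by
    have h1 : 0 ≤ S.p w.1 * S.p w.2 := (mul_pos (S.p_pos _) (S.p_pos _)).le
    rw [hG]
    simp only
    rw [norm_mul, norm_mul, norm_expNeg, one_mul, Complex.norm_real, Real.norm_eq_abs,
      abs_of_nonneg h1]
    exact mul_le_mul_of_nonneg_left (hz w (Finset.mem_univ _)) h1
  have htot : ∑ w : Fin n × Fin n, S.p w.1 * S.p w.2 = 1 := by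
    rw [Fintype.sum_prod_type]
    simp_rw [← Finset.mul_sum, S.p_sum, mul_one, S.p_sum]
  have h1 : ‖∑ w ∈ Finset.univ \ {(a, b), (b, a)}, G w‖ ≤ (1 - 2 * (S.p a * S.p b)) * M := by
    refine (norm_sum_le _ _).trans ((Finset.sum_le_sum fun w _ => hnorm w).trans ?_)
    rw [← Finset.sum_mul]
    refine le_of_eq (congrArg (· * M) ?_)
    have := Finset.sum_sdiff hsub (f := fun w => S.p w.1 * S.p w.2)
    rw [htot, Finset.sum_pair hpair] at this
    simp only at this
    linarith
  have h2 : ‖G (a, b) + G (b, a)‖ ≤ S.p a * S.p b * (2 * |Real.cos (Real.pi *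
        (ξ * (S.t a + S.r a * S.t b - (S.t b + S.r b * S.t a))))|) * M := by
    have hpos : 0 ≤ S.p a * S.p b := (mul_pos (S.p_pos _) (S.p_pos _)).le
    have : G (a, b) + G (b, a) = ((S.p a * S.p b : ℝ) : ℂ) *
        (expNeg (ξ * (S.t a + S.r a * S.t b)) + expNeg (ξ * (S.t b + S.r b * S.t a))) *
        fourierTransform μ (S.r a * S.r b * ξ) := by
      rw [hG]
      simp only
      rw [mul_comm (S.r b) (S.r a), mul_comm (S.p b)]
      ring
    rw [this, norm_mul, norm_mul, norm_expNeg_add_expNeg, Complex.norm_real, Real.norm_eq_abs,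
      abs_of_nonneg hpos, ← mul_sub]
    exact mul_le_mul_of_nonneg_left (hz (a, b) (Finset.mem_univ _)) (by positivity)
  rw [hμ.fourierTransform_eq_sum_sum, ← Finset.sum_sdiff hsub, Finset.sum_pair hpair]
  refine (norm_add_le _ _).trans ((add_le_add h1 h2).trans (le_of_eq ?_))
  ring

end IsCarriedStationary

/-! ### Contraction ratios of words, indexed by letter counts. -/

namespace AffineIFS

variable {n : ℕ} (S : AffineIFS n)

def ratio (k : Fin n → ℕ) : ℝ := ∏ a, |S.r a| ^ k a

lemma ratio_zero : S.ratio 0 = 1 := by simp [ratio]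

lemma ratio_pos (k : Fin n → ℕ) : 0 < S.ratio k :=
  Finset.prod_pos fun a _ => pow_pos (S.abs_r_pos a) _

lemma ratio_add_single (k : Fin n → ℕ) (a : Fin n) :
    S.ratio (k + Pi.single a 1) = S.ratio k * |S.r a| := by
  simp only [ratio, Pi.add_apply, pow_add, Finset.prod_mul_distrib]
  congr 1
  rw [Finset.prod_eq_single a]
  · simp
  · intro b _ hb
    simp [hb]
  · simp

lemma lo_pow_le_ratio (k : Fin n → ℕ) : S.lo ^ (∑ a, k a) ≤ S.ratio k := by
  rw [ratio, ← Finset.prod_pow_eq_pow_sum]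
  exact Finset.prod_le_prod (fun a _ => pow_nonneg S.lo_pos.le _)
    fun a _ => pow_le_pow_left₀ S.lo_pos.le (S.lo_le a) _

lemma ratio_le_hi_pow (k : Fin n → ℕ) : S.ratio k ≤ S.hi ^ (∑ a, k a) := by
  rw [ratio, ← Finset.prod_pow_eq_pow_sum]
  exact Finset.prod_le_prod (fun a _ => pow_nonneg (abs_nonneg _) _)
    fun a _ => pow_le_pow_left₀ (abs_nonneg _) (S.le_hi a) _

/-- Multi-exponents with entries at most `m`. -/
def exponents (n m : ℕ) : Finset (Fin n → ℕ) := Fintype.piFinset fun _ => Finset.range (m + 1)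

lemma mem_exponents {m : ℕ} {k : Fin n → ℕ} : k ∈ exponents n m ↔ ∀ a, k a ≤ m := by
  simp [exponents]

lemma card_exponents (m : ℕ) : (exponents n m).card = (m + 1) ^ n := by
  simp [exponents]

/-- The contraction ratios of words of length `m`. -/
def ratios (m : ℕ) : Finset ℝ :=
  ((exponents n m).filter fun k => ∑ a, k a = m).image S.ratio

lemma ratio_mem_ratios {m : ℕ} {k : Fin n → ℕ} (hk : ∑ a, k a = m) : S.ratio k ∈ S.ratios m := by
  refine Finset.mem_image_of_mem _ (Finset.mem_filter.2 ⟨mem_exponents.2 fun a => ?_, hk⟩)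
  rw [← hk]
  exact Finset.single_le_sum (fun _ _ => Nat.zero_le _) (Finset.mem_univ a)

lemma card_ratios_le (m : ℕ) : (S.ratios m).card ≤ (m + 1) ^ n :=
  Finset.card_image_le.trans ((Finset.card_filter_le _ _).trans (card_exponents m).le)

lemma bounds_of_mem_ratios {m : ℕ} {ρ : ℝ} (h : ρ ∈ S.ratios m) :
    S.lo ^ m ≤ ρ ∧ ρ ≤ S.hi ^ m := by
  obtain ⟨k, hk, rfl⟩ := Finset.mem_image.1 h
  have hm := (Finset.mem_filter.1 hk).2
  rw [← hm]
  exact ⟨S.lo_pow_le_ratio k, S.ratio_le_hi_pow k⟩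

end AffineIFS

namespace IsCarriedStationary

variable {n : ℕ} {S : AffineIFS n} {μ : Measure ℝ}

lemma exists_exponent_norm_fourierTransform_le (hμ : IsCarriedStationary S μ) (j : Fin n → ℕ)
    (m : ℕ) (ξ : ℝ) : ∃ k : Fin n → ℕ, ∑ a, k a = (∑ a, j a) + m ∧
      ‖fourierTransform μ (S.ratio j * ξ)‖ ≤ ‖fourierTransform μ (S.ratio k * ξ)‖ := by
  induction m with
  | zero => exact ⟨j, by simp, le_rfl⟩
  | succ m ih =>
    obtain ⟨k, hk, hle⟩ := ih
    obtain ⟨a, ha⟩ := hμ.exists_norm_fourierTransform_le (S.ratio k * ξ)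
    refine ⟨k + Pi.single a 1, ?_, hle.trans (ha.trans (le_of_eq ?_))⟩
    · simp [Finset.sum_add_distrib, hk, add_assoc]
    · rw [S.ratio_add_single]
      congr 2
      ring

/-- The first two letters produce the gain; the other `m` only lengthen the contraction without
decreasing the modulus. -/
lemma exists_ratio_gain (hμ : IsCarriedStationary S μ) {a b : Fin n} (hab : a ≠ b) {c : ℝ}
    (hc : 0 ≤ c) (m : ℕ) (ξ : ℝ) : ∃ ρ ∈ S.ratios (m + 2),
      ‖fourierTransform μ ξ‖ ≤ ‖fourierTransform μ (ρ * ξ)‖ ∧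
      ∀ x, x = ξ * (S.t a + S.r a * S.t b - (S.t b + S.r b * S.t a)) → c ≤ |x - round x| →
        ‖fourierTransform μ ξ‖ ≤ (1 - 2 * (S.p a * S.p b) * (1 - Real.cos (Real.pi * c))) *
          ‖fourierTransform μ (ρ * ξ)‖ := by
  obtain ⟨d, e, h⟩ := hμ.exists_norm_fourierTransform_le_of_two hab ξ
  obtain ⟨k, hk, hle⟩ := hμ.exists_exponent_norm_fourierTransform_le
    (Pi.single d 1 + Pi.single e 1) m ξ
  have hj : S.ratio (Pi.single d 1 + Pi.single e 1) = |S.r d| * |S.r e| := by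
    rw [S.ratio_add_single, ← zero_add (Pi.single d 1), S.ratio_add_single, S.ratio_zero, one_mul]
  rw [hj] at hle
  have hpos : 0 < S.p a * S.p b := mul_pos (S.p_pos _) (S.p_pos _)
  have hsum : S.p a * S.p b * 2 ≤ 1 := by
    have h1 : S.p a + S.p b ≤ 1 := by
      rw [← S.p_sum, ← Finset.sum_pair hab]
      exact Finset.sum_le_sum_of_subset_of_nonneg (Finset.subset_univ _)
        fun i _ _ => (S.p_pos i).le
    nlinarith [S.p_pos a, S.p_pos b, sq_nonneg (S.p a - S.p b)]
  refine ⟨S.ratio k, S.ratio_mem_ratios ?_, h.trans ?_, fun x hx hcx => h.trans ?_⟩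
  · rw [hk]
    simp [Finset.sum_add_distrib]
    omega
  · refine le_trans (mul_le_of_le_one_left (norm_nonneg _) ?_) hle
    have := Real.abs_cos_le_one (Real.pi *
      (ξ * (S.t a + S.r a * S.t b - (S.t b + S.r b * S.t a))))
    nlinarith
  · rw [← hx]
    have h1 := abs_cos_pi_mul_le hc hcx
    have h2 : Real.cos (Real.pi * c) ≤ 1 := Real.cos_le_one _
    have h3 : 0 ≤ |Real.cos (Real.pi * x)| := abs_nonneg _
    refine mul_le_mul ?_ hle (norm_nonneg _) ?_
    · nlinarith
    · nlinarith

end IsCarriedStationary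

/-! ### Sparsity of the large Fourier coefficients. -/

lemma exists_two_mul_pow_le (n : ℕ) {w : ℝ} (hw : 1 < w) :
    ∃ m : ℕ, 2 * ((m : ℝ) + 3) ^ n ≤ w ^ (m + 2) := by
  have h := tendsto_pow_const_div_const_pow_of_one_lt n hw
  have hpos : (0 : ℝ) < 1 / (2 * 2 ^ n) := by positivity
  obtain ⟨m, hm⟩ := Filter.eventually_atTop.1 (h.eventually (gt_mem_nhds hpos))
  refine ⟨m, ?_⟩
  have h1 := hm (m + 2) (by omega)
  have hw' : 0 < w ^ (m + 2) := pow_pos (by linarith) _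
  rw [div_lt_iff₀ hw', one_div, ← div_eq_inv_mul, lt_div_iff₀ (by positivity)] at h1
  push_cast at h1
  have h2 : ((m : ℝ) + 3) ^ n ≤ (2 * ((m : ℝ) + 2)) ^ n := by
    have : (0 : ℝ) ≤ m := Nat.cast_nonneg m
    gcongr
    linarith
  rw [mul_pow] at h2
  linarith

/-- Turns a branching count over `k + 1` levels into a power of the scale `x`; the extra level costs
`y ^ e`. -/
lemma pow_le_mul_rpow {b y x e : ℝ} {k : ℕ} (hb : 0 ≤ b) (hy : 0 < y) (he : 0 ≤ e) (hbe : b ≤ y ^ e)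
    (hyx : y ^ k ≤ x) : b ^ (k + 1) ≤ y ^ e * x ^ e := by
  have h1 : (y ^ k) ^ e ≤ x ^ e := Real.rpow_le_rpow (by positivity) hyx he
  calc b ^ (k + 1) ≤ (y ^ e) ^ (k + 1) := pow_le_pow_left₀ hb hbe _
    _ = y ^ e * (y ^ k) ^ e := by
        rw [pow_succ', ← Real.rpow_natCast y k, ← Real.rpow_mul hy.le, mul_comm (k : ℝ) e,
          Real.rpow_mul hy.le, Real.rpow_natCast]
    _ ≤ y ^ e * x ^ e := by gcongr

namespace IsCarriedStationary

variable {n : ℕ} {S : AffineIFS n} {μ : Measure ℝ}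

/-- The Fourier transform of a self-similar measure decays polynomially outside a sparse set of
frequencies. -/
theorem exists_cover_fourierTransform (hμ : IsCarriedStationary S μ) {a b : Fin n}
    (hτ : S.t a + S.r a * S.t b - (S.t b + S.r b * S.t a) ≠ 0) {ε : ℝ} (hε : 0 < ε) :
    ∃ δ C : ℝ, 0 < δ ∧ 0 < C ∧ ∀ T : ℝ, 1 ≤ T → ∃ Y : Finset ℝ, (Y.card : ℝ) ≤ C * T ^ ε ∧
      ∀ ξ, |ξ| ≤ T → T ^ (-δ) ≤ ‖fourierTransform μ ξ‖ → ∃ y ∈ Y, |ξ - y| ≤ C := by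
  have := hμ.prob
  have hab : a ≠ b := by
    rintro rfl
    exact hτ (sub_self _)
  set τ := S.t a + S.r a * S.t b - (S.t b + S.r b * S.t a) with hτdef
  have hτ0 : 0 < |τ| := abs_pos.2 hτ
  have hhi := S.hi_pos
  have hhi1 := S.hi_lt_one
  have hε2 : 0 < ε / 2 := by linarith
  have hw : 1 < (S.hi⁻¹) ^ (ε / 2) := Real.one_lt_rpow ((one_lt_inv₀ hhi).2 hhi1) hε2
  -- Blocks so long that twice the number of ratios is at most `H ^ (-(ε / 2))`, with `H` the
  -- largest possible block contraction.
  obtain ⟨m, hm⟩ := exists_two_mul_pow_le n hw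
  set lo := S.lo ^ (m + 2) with hlo_def
  have hlo : 0 < lo := pow_pos S.lo_pos _
  set H := S.hi ^ (m + 2) with hH_def
  have hH : 0 < H := pow_pos hhi _
  have hH1 : H < 1 := pow_lt_one₀ hhi.le hhi1 (by omega)
  set c := 1 / (4 * (1 + 1 / lo)) with hc_def
  have hden : 1 < 1 + 1 / lo := by
    have : 0 < 1 / lo := by positivity
    linarith
  have hc : 0 < c := by positivity
  have hclo : c * (1 + 1 / lo) < 1 / 2 := by
    rw [hc_def]
    have : (1 / (4 * (1 + 1 / lo))) * (1 + 1 / lo) = 1 / 4 := by field_simp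
    rw [this]
    norm_num
  have hc2 : c < 1 / 2 := by nlinarith
  have hcos : Real.cos (Real.pi * c) < 1 := by
    rw [← Real.cos_zero]
    exact Real.cos_lt_cos_of_nonneg_of_le_pi_div_two le_rfl (by nlinarith [Real.pi_pos])
      (mul_pos Real.pi_pos hc)
  have hpp : 0 < S.p a * S.p b := mul_pos (S.p_pos _) (S.p_pos _)
  set q := max (1 / 2) (1 - 2 * (S.p a * S.p b) * (1 - Real.cos (Real.pi * c))) with hq_def
  have hq : 0 < q := lt_max_of_lt_left (by norm_num)
  have hq1 : q < 1 := max_lt (by norm_num) (by nlinarith)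
  set B := ⌈1 / lo⌉₊ with hB_def
  -- Rescaling by `τ` places the points without gain near the integers.
  have hcover := exists_cover_of_gain (h := fun x => ‖fourierTransform μ (x / τ)‖)
    (R := S.ratios (m + 2)) (B := B) hlo (fun ρ hρ => S.bounds_of_mem_ratios hρ) hH hc hclo hq hq1
    (Nat.le_ceil _) (fun x => norm_fourierTransform_le_one μ _) (fun x => by
      obtain ⟨ρ, hρ, h1, h2⟩ := hμ.exists_ratio_gain hab hc.le m (x / τ)
      refine ⟨ρ, hρ, by rwa [mul_div_assoc], fun hx => ?_⟩
      rw [mul_div_assoc]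
      exact (h2 x (by rw [← hτdef]; field_simp) hx).trans
        (mul_le_mul_of_nonneg_right (le_max_right _ _) (norm_nonneg _)))
  set y := H⁻¹ with hy_def
  have hy1 : 1 < y := (one_lt_inv₀ hH).2 hH1
  set u := q⁻¹ with hu_def
  have hu1 : 1 < u := (one_lt_inv₀ hq).2 hq1
  set A := max 1 (|τ| / c) with hA_def
  have hA : 1 ≤ A := le_max_left _ _
  have hlogu : 0 < Real.log u := Real.log_pos hu1
  have hB1 : (1 : ℝ) < 2 * B + 1 := by
    have : 0 < B := Nat.ceil_pos.2 (by positivity)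
    have : (0 : ℝ) < B := by exact_mod_cast this
    linarith
  set κ := Real.log (2 * B + 1) / Real.log u with hκ_def
  have hκ : 0 < κ := div_pos (Real.log_pos hB1) hlogu
  have hκu : (2 * B + 1 : ℝ) = u ^ κ := by
    rw [Real.rpow_def_of_pos (by linarith), hκ_def, mul_div_cancel₀ _ hlogu.ne',
      Real.exp_log (by linarith)]
  have hP : (2 * (S.ratios (m + 2)).card : ℝ) ≤ y ^ (ε / 2) := by
    have h1 : ((S.ratios (m + 2)).card : ℝ) ≤ ((m : ℝ) + 3) ^ n := by
      have := S.card_ratios_le (m + 2)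
      have h2 : (((S.ratios (m + 2)).card : ℕ) : ℝ) ≤ (((m + 2 + 1) ^ n : ℕ) : ℝ) := by
        exact_mod_cast this
      refine h2.trans (le_of_eq ?_)
      push_cast
      ring
    have h2 : y ^ (ε / 2) = (S.hi⁻¹ ^ (ε / 2)) ^ (m + 2) := by
      rw [hy_def, hH_def, ← inv_pow, ← Real.rpow_natCast, ← Real.rpow_natCast, ← Real.rpow_mul
        (inv_pos.2 hhi).le, ← Real.rpow_mul (inv_pos.2 hhi).le, mul_comm]
    rw [h2]
    linarith
  -- Half of `ε` pays for the levels and half for the gains: `2 * B + 1 = u ^ κ`, so `u ^ j ≤ T ^ (ε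
  -- / 2 / κ)` gives `(2 * B + 1) ^ j ≤ T ^ (ε / 2)`.
  refine ⟨ε / 2 / κ, (y ^ (ε / 2) * A ^ (ε / 2)) * u ^ κ + c / |τ|, by positivity, ?_, ?_⟩
  · have : 0 < y := by linarith
    have : 0 < u := by linarith
    positivity
  intro T hT
  have hT0 : 0 < T := by linarith
  have hy0 : 0 < y := by linarith
  have hu0 : 0 < u := by linarith
  have hA0 : 0 < A := by linarith
  obtain ⟨N, hN1, hN2⟩ := exists_nat_pow_near (one_le_mul_of_one_le_of_one_le hA hT) hy1
  obtain ⟨j, hj1, hj2⟩ := exists_nat_pow_near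
    (Real.one_le_rpow hT (by positivity : 0 ≤ ε / 2 / κ)) hu1
  obtain ⟨Y, hYc, hY⟩ := hcover (N + 1) (j + 1)
  refine ⟨Y.image (· / τ), ?_, ?_⟩
  · have h1 : (Y.card : ℝ) ≤ (2 * (S.ratios (m + 2)).card : ℝ) ^ (N + 1) *
        (2 * B + 1 : ℝ) ^ (j + 1) := by exact_mod_cast hYc
    have h2 := pow_le_mul_rpow
      (mul_nonneg two_pos.le (Nat.cast_nonneg (S.ratios (m + 2)).card)) hy0 hε2.le hP hN1
    have h3 := pow_le_mul_rpow (by linarith) hu0 hκ.le hκu.le hj1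
    rw [← Real.rpow_mul hT0.le, div_mul_cancel₀ _ hκ.ne'] at h3
    rw [Real.mul_rpow hA0.le hT0.le] at h2
    have h4 : ((Y.image (· / τ)).card : ℝ) ≤ Y.card := by exact_mod_cast Finset.card_image_le
    calc ((Y.image (· / τ)).card : ℝ)
        ≤ (2 * (S.ratios (m + 2)).card : ℝ) ^ (N + 1) * (2 * B + 1 : ℝ) ^ (j + 1) := h4.trans h1
      _ ≤ (y ^ (ε / 2) * (A ^ (ε / 2) * T ^ (ε / 2))) * (u ^ κ * T ^ (ε / 2)) := by gcongr
      _ = ((y ^ (ε / 2) * A ^ (ε / 2)) * u ^ κ) * T ^ ε := by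
          rw [show T ^ ε = T ^ (ε / 2) * T ^ (ε / 2) by
            rw [← Real.rpow_add hT0, add_halves]]
          ring
      _ ≤ _ := by
          gcongr
          have : 0 ≤ c / |τ| := by positivity
          linarith
  · intro ξ hξ hle
    have h1 : |ξ * τ| ≤ c / H ^ (N + 1) := by
      have h2 : |τ| / c ≤ A := le_max_right _ _
      rw [div_le_iff₀ hc] at h2
      rw [div_eq_mul_inv, ← inv_pow, ← hy_def, abs_mul]
      calc |ξ| * |τ| ≤ T * (A * c) := mul_le_mul hξ h2 hτ0.le hT0.le
        _ = c * (A * T) := by ring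
        _ ≤ c * y ^ (N + 1) := by gcongr
    have h2 : q ^ (j + 1) ≤ ‖fourierTransform μ (ξ * τ / τ)‖ := by
      rw [mul_div_cancel_right₀ _ hτ]
      refine le_trans ?_ hle
      rw [Real.rpow_neg hT0.le, le_inv_comm₀ (by positivity) (by positivity), ← inv_pow]
      exact hj2.le
    obtain ⟨z, hz, hxz⟩ := hY (ξ * τ) h1 h2
    refine ⟨z / τ, Finset.mem_image_of_mem _ hz, ?_⟩
    have h3 : ξ - z / τ = (ξ * τ - z) / τ := by field_simp
    rw [h3, abs_div]
    have h4 : |ξ * τ - z| / |τ| ≤ c / |τ| := by gcongr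
    have h5 : 0 ≤ (y ^ (ε / 2) * A ^ (ε / 2)) * u ^ κ := by positivity
    linarith

end IsCarriedStationary

/-! ### Hölder regularity of the measure. -/

lemma AffineIFS.preimage_closedBall {n : ℕ} (S : AffineIFS n) (a : Fin n) (x ρ : ℝ) :
    S.toMap a ⁻¹' Metric.closedBall x ρ =
      Metric.closedBall ((x - S.t a) / S.r a) (ρ / |S.r a|) := by
  ext z
  have h : z - (x - S.t a) / S.r a = (S.r a * z + S.t a - x) / S.r a := by
    have := S.r_ne a
    field_simp
    ring
  simp only [mem_preimage, Metric.mem_closedBall, Real.dist_eq, AffineIFS.toMap]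
  rw [h, abs_div, div_le_div_iff_of_pos_right (S.abs_r_pos a)]

namespace IsCarriedStationary

variable {n : ℕ} {S : AffineIFS n} {μ : Measure ℝ}

/-- Peel off the letter `a` up to `k` times. The mass diverted to other letters has total weight `1
- p a ^ k` and meets only balls of radius at most `ρ / lo ^ k`. -/
lemma measureReal_closedBall_le (hμ : IsCarriedStationary S μ) (a : Fin n) (k : ℕ) {V : ℝ} :
    ∀ x ρ : ℝ, 0 < ρ → (∀ x', μ.real (Metric.closedBall x' (ρ / S.lo ^ k)) ≤ V) →
      μ.real (Metric.closedBall x ρ) ≤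
        S.p a ^ k * μ.real ((S.toMap a)^[k] ⁻¹' Metric.closedBall x ρ) + (1 - S.p a ^ k) * V := by
  have := hμ.prob
  have hlo := S.lo_pos
  have hlo1 : S.lo ≤ 1 := S.lo_le_hi.trans S.hi_lt_one.le
  induction k with
  | zero => intro x ρ hρ hV; simp
  | succ k ih =>
    intro x ρ hρ hV
    have hrad : ∀ b, ρ / |S.r b| ≤ ρ / S.lo := fun b =>
      div_le_div_of_nonneg_left hρ.le hlo (S.lo_le b)
    have hpow : S.lo ^ (k + 1) ≤ S.lo := by
      simpa using pow_le_pow_of_le_one hlo.le hlo1 (show 1 ≤ k + 1 by omega)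
    have hb : ∀ b, μ.real (S.toMap b ⁻¹' Metric.closedBall x ρ) ≤ V := fun b => by
      rw [S.preimage_closedBall]
      refine le_trans (measureReal_mono (Metric.closedBall_subset_closedBall ?_)) (hV _)
      exact (hrad b).trans (div_le_div_of_nonneg_left hρ.le (by positivity) hpow)
    have ha : μ.real (S.toMap a ⁻¹' Metric.closedBall x ρ) ≤
        S.p a ^ k * μ.real ((S.toMap a)^[k + 1] ⁻¹' Metric.closedBall x ρ) +
          (1 - S.p a ^ k) * V := by
      rw [Function.iterate_succ', preimage_comp, S.preimage_closedBall]
      refine ih _ _ (div_pos hρ (S.abs_r_pos a)) fun x' => ?_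
      refine le_trans (measureReal_mono (Metric.closedBall_subset_closedBall ?_)) (hV x')
      rw [pow_succ', ← div_div]
      gcongr
      exact S.lo_le a
    rw [hμ.measureReal_eq Metric.isClosed_closedBall.measurableSet,
      ← Finset.add_sum_erase _ _ (Finset.mem_univ a)]
    have hrest : ∑ b ∈ Finset.univ.erase a,
        S.p b * μ.real (S.toMap b ⁻¹' Metric.closedBall x ρ) ≤ (1 - S.p a) * V := by
      have h1 := Finset.add_sum_erase Finset.univ S.p (Finset.mem_univ a)
      rw [S.p_sum] at h1
      rw [← h1, add_sub_cancel_left, Finset.sum_mul]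
      exact Finset.sum_le_sum fun b _ => mul_le_mul_of_nonneg_left (hb b) (S.p_pos b).le
    calc _ ≤ S.p a * (S.p a ^ k * μ.real ((S.toMap a)^[k + 1] ⁻¹' Metric.closedBall x ρ) +
          (1 - S.p a ^ k) * V) + (1 - S.p a) * V :=
          add_le_add (mul_le_mul_of_nonneg_left ha (S.p_pos a).le) hrest
      _ = _ := by ring

lemma measureReal_closedBall_le_of_miss (hμ : IsCarriedStationary S μ) (a : Fin n) (k : ℕ)
    {V x ρ : ℝ} (hρ : 0 < ρ) (hV : ∀ x', μ.real (Metric.closedBall x' (ρ / S.lo ^ k)) ≤ V)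
    (hmiss : ∀ z ∈ Icc (0 : ℝ) 1, (S.toMap a)^[k] z ∉ Metric.closedBall x ρ) :
    μ.real (Metric.closedBall x ρ) ≤ (1 - S.p a ^ k) * V := by
  have h := hμ.measureReal_closedBall_le a k x ρ hρ hV
  have h0 : μ.real ((S.toMap a)^[k] ⁻¹' Metric.closedBall x ρ) = 0 :=
    measureReal_eq_zero fun z hz => hmiss z (hμ.supp hz)
  rwa [h0, mul_zero, zero_add] at h

/-- A self-similar measure which is not a point mass is Hölder regular. -/
theorem exists_frostman (hμ : IsCarriedStationary S μ) {a b : Fin n}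
    (hab : S.fixedPoint a ≠ S.fixedPoint b) :
    ∃ C s : ℝ, 0 < C ∧ 0 < s ∧ ∀ x ρ, 0 < ρ → μ.real (Metric.closedBall x ρ) ≤ C * ρ ^ s := by
  have := hμ.prob
  have hlo := S.lo_pos
  have hlo1 : S.lo < 1 := S.lo_le_hi.trans_lt S.hi_lt_one
  set D := |S.fixedPoint a - S.fixedPoint b| with hD_def
  have hD : 0 < D := abs_pos.2 (sub_ne_zero.2 hab)
  set E := 1 + |S.fixedPoint a| + |S.fixedPoint b| with hE_def
  have hE : 0 < E := by positivity
  obtain ⟨k₀, hk₀⟩ := exists_pow_lt_of_lt_one (div_pos hD (mul_pos (by norm_num : (0 : ℝ) < 8) hE))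
    S.hi_lt_one
  -- The successor ensures `k ≥ 1`, needed for `1 < M`.
  set k := k₀ + 1 with hk_def
  have hk : S.hi ^ k * E ≤ D / 8 := by
    have h1 : S.hi ^ k ≤ S.hi ^ k₀ := pow_le_pow_of_le_one S.hi_pos.le S.hi_lt_one.le (by omega)
    rw [lt_div_iff₀ (by positivity)] at hk₀
    nlinarith
  have hnear : ∀ i, |S.fixedPoint i| ≤ |S.fixedPoint a| + |S.fixedPoint b| → ∀ z ∈ Icc (0 : ℝ) 1,
      |(S.toMap i)^[k] z - S.fixedPoint i| ≤ D / 8 := by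
    intro i hi z hz
    rw [S.toMap_iterate, add_sub_cancel_left, abs_mul, abs_pow]
    refine le_trans (mul_le_mul (pow_le_pow_left₀ (abs_nonneg _) (S.le_hi i) k) ?_
      (abs_nonneg _) (pow_nonneg S.hi_pos.le _)) hk
    refine (abs_sub _ _).trans ?_
    rw [abs_of_nonneg hz.1]
    linarith [hz.2]
  have hna := hnear a (by linarith [abs_nonneg (S.fixedPoint b)])
  have hnb := hnear b (by linarith [abs_nonneg (S.fixedPoint a)])
  -- Halving keeps `θ` positive without excluding weights equal to one.
  set π := min (S.p a ^ k) (S.p b ^ k) / 2 with hπ_def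
  have hpa : 0 < S.p a ^ k := pow_pos (S.p_pos a) _
  have hpb : 0 < S.p b ^ k := pow_pos (S.p_pos b) _
  have hple : S.p a ≤ 1 := by
    rw [← S.p_sum]
    exact Finset.single_le_sum (fun i _ => (S.p_pos i).le) (Finset.mem_univ a)
  have hpa1 : S.p a ^ k ≤ 1 := pow_le_one₀ (S.p_pos a).le hple
  have hmin : 0 < min (S.p a ^ k) (S.p b ^ k) := lt_min hpa hpb
  have hmin1 : min (S.p a ^ k) (S.p b ^ k) ≤ 1 := (min_le_left _ _).trans hpa1
  set θ := 1 - π with hθ_def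
  have hθ0 : 0 < θ := by linarith
  have hθ1 : θ < 1 := by linarith
  have hθa : 1 - S.p a ^ k ≤ θ := by linarith [min_le_left (S.p a ^ k) (S.p b ^ k)]
  have hθb : 1 - S.p b ^ k ≤ θ := by linarith [min_le_right (S.p a ^ k) (S.p b ^ k)]
  -- The `k`-th iterates send `[0, 1]` within `D / 8` of the respective fixed points. A ball of
  -- radius at most `D / 8` meeting both images would give `D ≤ 4 * (D / 8)`, so it misses one of
  -- them.
  have hgain : ∀ V ρ : ℝ, 0 ≤ V → 0 < ρ → ρ ≤ D / 8 →
      (∀ x', μ.real (Metric.closedBall x' (ρ / S.lo ^ k)) ≤ V) →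
      ∀ x, μ.real (Metric.closedBall x ρ) ≤ θ * V := by
    intro V ρ hV0 hρ hρD hV x
    by_cases hmiss : ∀ z ∈ Icc (0 : ℝ) 1, (S.toMap a)^[k] z ∉ Metric.closedBall x ρ
    · exact (hμ.measureReal_closedBall_le_of_miss a k hρ hV hmiss).trans
        (mul_le_mul_of_nonneg_right hθa hV0)
    · refine (hμ.measureReal_closedBall_le_of_miss b k hρ hV fun w hw hwx => ?_).trans
        (mul_le_mul_of_nonneg_right hθb hV0)
      push Not at hmiss
      obtain ⟨z, hz, hzx⟩ := hmiss
      rw [Metric.mem_closedBall, Real.dist_eq] at hwx hzx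
      have h1 := abs_le.1 (hna z hz)
      have h2 := abs_le.1 (hnb w hw)
      have h3 := abs_le.1 hwx
      have h4 := abs_le.1 hzx
      have h5 : D ≤ D / 2 := by
        rw [hD_def, abs_le]
        rw [← hD_def]
        constructor <;> linarith
      linarith
  set M := (S.lo ^ k)⁻¹ with hM_def
  have hM1 : 1 < M := (one_lt_inv₀ (pow_pos hlo _)).2 (pow_lt_one₀ hlo.le hlo1 (by omega))
  have hM0 : 0 < M := by linarith
  have hiter : ∀ N : ℕ, ∀ x ρ, 0 < ρ → ρ * M ^ N ≤ D / 8 →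
      μ.real (Metric.closedBall x ρ) ≤ θ ^ N := by
    intro N
    induction N with
    | zero => intro x ρ _ _; simp
    | succ N ih =>
      intro x ρ hρ hle
      have hMN : 1 ≤ M ^ (N + 1) := one_le_pow₀ hM1.le
      rw [pow_succ']
      refine hgain (θ ^ N) ρ (by positivity) hρ (le_trans (by nlinarith) hle) (fun x' => ?_) x
      rw [div_eq_mul_inv, ← hM_def]
      refine ih x' _ (by positivity) ?_
      rwa [mul_assoc, ← pow_succ']
  set s := Real.log θ⁻¹ / Real.log M with hs_def
  have hlogM : 0 < Real.log M := Real.log_pos hM1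
  have hs : 0 < s := div_pos (Real.log_pos ((one_lt_inv₀ hθ0).2 hθ1)) hlogM
  have hMs : M ^ s = θ⁻¹ := by
    rw [Real.rpow_def_of_pos hM0, hs_def, mul_div_cancel₀ _ hlogM.ne',
      Real.exp_log (inv_pos.2 hθ0)]
  refine ⟨θ⁻¹ * ((D / 8)⁻¹) ^ s, s, by positivity, hs, fun x ρ hρ => ?_⟩
  have hrw : θ⁻¹ * (D / 8)⁻¹ ^ s * ρ ^ s = θ⁻¹ * (ρ / (D / 8)) ^ s := by
    rw [mul_assoc, ← Real.mul_rpow (by positivity) hρ.le, inv_mul_eq_div (D / 8) ρ]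
  rw [hrw]
  rcases le_or_gt ρ (D / 8) with hρD | hρD
  · obtain ⟨N, hN1, hN2⟩ := exists_nat_pow_near ((one_le_div hρ).2 hρD) hM1
    have h1 := hiter N x ρ hρ (by rw [le_div_iff₀ hρ] at hN1; linarith)
    refine h1.trans ?_
    have h2 : (ρ / (D / 8)) ^ s = ((D / 8 / ρ) ^ s)⁻¹ := by
      rw [← Real.inv_rpow (by positivity), inv_div]
    have h3 : (D / 8 / ρ) ^ s ≤ (θ⁻¹) ^ (N + 1) := by
      refine (Real.rpow_le_rpow (by positivity) hN2.le hs.le).trans (le_of_eq ?_)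
      rw [← hMs, ← Real.rpow_natCast, ← Real.rpow_natCast, ← Real.rpow_mul hM0.le,
        ← Real.rpow_mul hM0.le, mul_comm]
    rw [h2]
    have h4 : 0 < (D / 8 / ρ) ^ s := by positivity
    calc θ ^ N = θ⁻¹ * ((θ⁻¹) ^ (N + 1))⁻¹ := by
          rw [inv_pow, inv_inv, pow_succ]; field_simp
      _ ≤ _ := by gcongr
  · refine measureReal_le_one.trans ?_
    have h1 : 1 ≤ (ρ / (D / 8)) ^ s :=
      Real.one_le_rpow ((one_le_div (by positivity)).2 hρD.le) hs.le
    have h2 : 1 ≤ θ⁻¹ := ((one_lt_inv₀ hθ0).2 hθ1).le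
    nlinarith

end IsCarriedStationary

/-! ### Linearization on stopped pieces and decay for smooth phases. -/

lemma exists_succ_pow_le (n : ℕ) {w : ℝ} (hw : 1 < w) :
    ∃ C : ℝ, 0 < C ∧ ∀ j : ℕ, ((j : ℝ) + 1) ^ n ≤ C * w ^ j := by
  obtain ⟨M, hM⟩ := (tendsto_pow_const_div_const_pow_of_one_lt n hw).bddAbove_range
  have hw0 : 0 < w := by linarith
  refine ⟨max M 1 * w, by positivity, fun j => ?_⟩
  have h1 := hM (mem_range_self (j + 1))
  rw [div_le_iff₀ (by positivity)] at h1
  push_cast at h1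
  refine h1.trans ?_
  rw [mul_assoc, ← pow_succ']
  gcongr
  exact le_max_left _ _

namespace IsCarriedStationary

variable {n : ℕ} {S : AffineIFS n} {μ : Measure ℝ}

/-- To bound an integral it suffices to bound its pieces along the affine maps obtained by
iterating the system until the contraction ratio drops to the scale `ρ`. -/
lemma norm_integral_le_of_stopped (hμ : IsCarriedStationary S μ) {G : ℝ → ℂ} (hG : Measurable G)
    (hG1 : ∀ x, ‖G x‖ ≤ 1) {E : Set ℝ} (hE : MeasurableSet E) {ρ Q : ℝ}
    (H : ∀ k s v, |s| = S.ratio k → MapsTo (fun x => s * x + v) μ.support μ.support →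
      S.lo * ρ ≤ |s| → |s| ≤ ρ →
      ‖∫ x, G (s * x + v) ∂μ‖ ≤ Q + μ.real ((fun x => s * x + v) ⁻¹' E)) (N : ℕ) :
    ∀ k s v, |s| = S.ratio k → MapsTo (fun x => s * x + v) μ.support μ.support →
      S.lo * ρ ≤ |s| → |s| * S.hi ^ N ≤ ρ →
      ‖∫ x, G (s * x + v) ∂μ‖ ≤ Q + μ.real ((fun x => s * x + v) ⁻¹' E) := by
  induction N with
  | zero => exact fun k s v hs hmaps h1 h2 => H k s v hs hmaps h1 (by simpa using h2)
  | succ N ih =>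
    intro k s v hs hmaps h1 h2
    -- A piece is split only while `|s| > ρ`, so its children keep ratio at least `lo * ρ`. The
    -- masses of the preimages of `E` recombine by the same stationarity identity.
    rcases le_or_gt |s| ρ with hle | hgt
    · exact H k s v hs hmaps h1 hle
    have hmeas : Measurable fun x : ℝ => s * x + v := by fun_prop
    have hcomp : ∀ a x, s * S.toMap a x + v = s * S.r a * x + (s * S.t a + v) := fun a x => by
      rw [AffineIFS.toMap]; ring
    have hchild : ∀ a, ‖∫ x, G (s * S.toMap a x + v) ∂μ‖ ≤
        Q + μ.real (S.toMap a ⁻¹' ((fun x => s * x + v) ⁻¹' E)) := by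
      intro a
      have hset : S.toMap a ⁻¹' ((fun x => s * x + v) ⁻¹' E) =
          (fun x => s * S.r a * x + (s * S.t a + v)) ⁻¹' E := by
        ext x
        simp only [mem_preimage, hcomp]
      rw [hset]
      simp only [hcomp]
      refine ih (k + Pi.single a 1) _ _ ?_ ?_ ?_ ?_
      · rw [S.ratio_add_single, abs_mul, hs]
      · intro x hx
        have h3 : s * S.toMap a x + v ∈ μ.support := hmaps (hμ.mapsTo_support a hx)
        rwa [hcomp] at h3
      · rw [abs_mul, mul_comm S.lo]
        exact mul_le_mul hgt.le (S.lo_le a) S.lo_pos.le (abs_nonneg _)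
      · refine le_trans ?_ h2
        rw [abs_mul, mul_assoc, pow_succ']
        have := S.le_hi a
        have := S.hi_pos
        gcongr
    rw [hμ.integral_eq (f := fun x => G (s * x + v)) (hG.comp hmeas) fun x => hG1 _,
      hμ.measureReal_eq (hmeas hE)]
    calc ‖∑ a, (S.p a : ℂ) * ∫ x, G (s * S.toMap a x + v) ∂μ‖
        ≤ ∑ a, S.p a * (Q + μ.real (S.toMap a ⁻¹' ((fun x => s * x + v) ⁻¹' E))) := by
          refine (norm_sum_le _ _).trans (Finset.sum_le_sum fun a _ => ?_)
          rw [norm_mul, Complex.norm_real, Real.norm_eq_abs, abs_of_pos (S.p_pos a)]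
          exact mul_le_mul_of_nonneg_left (hchild a) (S.p_pos a).le
      _ = Q + ∑ a, S.p a * μ.real (S.toMap a ⁻¹' ((fun x => s * x + v) ⁻¹' E)) := by
          simp_rw [mul_add]
          rw [Finset.sum_add_distrib, ← Finset.sum_mul, S.p_sum, one_mul]

/-- Linearization of the phase along an affine map. -/
lemma norm_integral_expNeg_le_of_taylor (hμ : IsCarriedStationary S μ) {F : ℝ → ℝ}
    (hF : Measurable F) {ξ s v x₀ d e : ℝ}
    (htaylor : ∀ x ∈ μ.support, |F (s * x + v) - F (s * x₀ + v) - d * (s * (x - x₀))| ≤ e) :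
    ‖∫ x, expNeg (ξ * F (s * x + v)) ∂μ‖ ≤
      ‖fourierTransform μ (ξ * |s| * d)‖ + 2 * Real.pi * (|ξ| * e) := by
  have := hμ.prob
  set L : ℝ → ℝ := fun x => ξ * (F (s * x₀ + v) + d * (s * (x - x₀))) with hL
  have hLc : Continuous L := by rw [hL]; fun_prop
  have hFm : Measurable fun x => ξ * F (s * x + v) :=
    (hF.comp (by fun_prop : Measurable fun x : ℝ => s * x + v)).const_mul ξ
  have hbd : ∀ f : ℝ → ℝ, Measurable f → Integrable (fun x => expNeg (f x)) μ := fun f hf =>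
    Integrable.of_bound (continuous_expNeg.measurable.comp hf).aestronglyMeasurable 1
      (Filter.Eventually.of_forall fun x => (norm_expNeg _).le)
  have hlin : ‖∫ x, expNeg (L x) ∂μ‖ = ‖fourierTransform μ (ξ * |s| * d)‖ := by
    have h1 : ∀ x, expNeg (L x) =
        expNeg (ξ * (F (s * x₀ + v) - d * (s * x₀))) * expNeg (ξ * s * d * x) := fun x => by
      rw [← expNeg_add]
      congr 1
      rw [hL]
      ring
    simp only [h1, integral_const_mul]
    rw [norm_mul, norm_expNeg, one_mul, ← fourierTransform_eq]
    exact norm_fourierTransform_of_abs_eq μ (by simp [abs_mul])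
  have hdiff : ‖∫ x, expNeg (ξ * F (s * x + v)) ∂μ - ∫ x, expNeg (L x) ∂μ‖ ≤
      2 * Real.pi * (|ξ| * e) := by
    rw [← integral_sub (hbd _ hFm) (hbd _ hLc.measurable)]
    have := norm_integral_le_of_norm_le_const (μ := μ)
      (f := fun x => expNeg (ξ * F (s * x + v)) - expNeg (L x)) (C := 2 * Real.pi * (|ξ| * e)) ?_
    · simpa using this
    filter_upwards [Measure.support_mem_ae (μ := μ)] with x hx
    refine (norm_expNeg_sub_le _ _).trans ?_
    have hsub : ξ * F (s * x + v) - L x =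
        ξ * (F (s * x + v) - F (s * x₀ + v) - d * (s * (x - x₀))) := by
      rw [hL]; ring
    rw [hsub, abs_mul]
    have := htaylor x hx
    have := Real.pi_pos
    gcongr
  rw [← hlin]
  linarith [norm_sub_norm_le (∫ x, expNeg (ξ * F (s * x + v)) ∂μ) (∫ x, expNeg (L x) ∂μ)]

set_option maxHeartbeats 1000000 in
/-- Polynomial decay for a phase `F` with derivative `D`, when `D` pushes `μ` to a measure with
Hölder regularity. -/
theorem exists_decay_of_sublevel (hμ : IsCarriedStationary S μ) {a b : Fin n}
    (hτ : S.t a + S.r a * S.t b - (S.t b + S.r b * S.t a) ≠ 0) {F D : ℝ → ℝ}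
    (hF : Measurable F) (hD : Measurable D) {A s : ℝ} (hA : 1 ≤ A) (hs : 0 < s)
    (hDA : ∀ x ∈ Icc (0 : ℝ) 1, |D x| ≤ A)
    (hDL : ∀ x ∈ Icc (0 : ℝ) 1, ∀ y ∈ Icc (0 : ℝ) 1, |D x - D y| ≤ A * |x - y|)
    (hFT : ∀ x ∈ Icc (0 : ℝ) 1, ∀ y ∈ Icc (0 : ℝ) 1,
      |F y - F x - D x * (y - x)| ≤ A * (y - x) ^ 2)
    (hsub : ∀ c h, 0 < h → μ.real {x | x ∈ Icc (0 : ℝ) 1 ∧ |D x - c| ≤ h} ≤ A * h ^ s) :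
    ∃ C η : ℝ, 0 < C ∧ 0 < η ∧ ∀ ξ Z : ℝ, 1 ≤ Z → |ξ| = Z ^ 3 →
      ‖∫ x, expNeg (ξ * F x) ∂μ‖ ≤ C * Z ^ (-η) := by
  have := hμ.prob
  have hA0 : 0 < A := by linarith
  have hlo := S.lo_pos
  have hlo1 : S.lo ≤ 1 := S.lo_le_hi.trans S.hi_lt_one.le
  obtain ⟨x₀, hx₀⟩ := hμ.support_nonempty
  obtain ⟨δ, C, hδ, hC, hcover⟩ := hμ.exists_cover_fourierTransform hτ
    (show 0 < s / 4 by linarith)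
  have hw : 1 < S.hi⁻¹ := (one_lt_inv₀ S.hi_pos).2 S.hi_lt_one
  have hw0 : 0 < S.hi⁻¹ := by linarith
  -- The exponent is `s / 8` because the pieces have scale `Z ^ (-2)`: the number of ratios becomes
  -- `O(Z ^ (s / 4))`.
  obtain ⟨C₁, hC₁, hcount⟩ := exists_succ_pow_le n
    (Real.one_lt_rpow hw (show 0 < s / 8 by linarith))
  -- The first term is the radius of the exceptional balls divided by `|ξ| * |σ| ≥ lo * Z`, the
  -- second the oscillation of `D` on a piece, both in units of `1 / Z`.
  set h₁ := C / S.lo + A with hh₁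
  have hh₁0 : 0 < h₁ := by positivity
  set C₂ := C₁ * (S.lo⁻¹) ^ (s / 8) * (C * A ^ (s / 4)) * (A * h₁ ^ s) with hC₂
  set η := min (min δ 1) (s / 2) with hη
  refine ⟨1 + 2 * Real.pi * A + C₂, η, by positivity,
    lt_min (lt_min hδ one_pos) (by linarith), fun ξ Z hZ hξ => ?_⟩
  have hZ0 : 0 < Z := by linarith
  set ρ := (Z ^ 2)⁻¹ with hρ_def
  have hρ : 0 < ρ := by positivity
  have hρ1 : ρ ≤ 1 := inv_le_one_of_one_le₀ (one_le_pow₀ hZ)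
  have hξ0 : ξ ≠ 0 := by
    rintro rfl
    have : 0 < Z ^ 3 := by positivity
    simp at hξ
    linarith
  -- `J` bounds each letter count of a stopped word, since `hi ^ k i ≥ lo * ρ`.
  obtain ⟨J, hJ1, hJ2⟩ := exists_nat_pow_near
    (show 1 ≤ S.lo⁻¹ * Z ^ 2 from one_le_mul_of_one_le_of_one_le
      ((one_le_inv₀ hlo).2 hlo1) (one_le_pow₀ hZ)) hw
  have hT : 1 ≤ A * Z := one_le_mul_of_one_le_of_one_le hA hZ
  obtain ⟨Y, hYc, hY⟩ := hcover (A * Z) hT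
  set h := h₁ * Z⁻¹ with hh
  have hh0 : 0 < h := by positivity
  set B : (Fin n → ℕ) → ℝ → Set ℝ := fun k e =>
    {x | x ∈ Icc (0 : ℝ) 1 ∧ |D x - e / (ξ * S.ratio k)| ≤ h} with hB
  set E : Set ℝ := ⋃ k ∈ AffineIFS.exponents n J, ⋃ e ∈ Y, B k e with hE_def
  have hBm : ∀ k e, MeasurableSet (B k e) := fun k e =>
    measurableSet_Icc.inter (measurableSet_le (hD.sub_const _).abs measurable_const)
  have hE : MeasurableSet E := Finset.measurableSet_biUnion _ fun k _ =>
    Finset.measurableSet_biUnion _ fun e _ => hBm k e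
  have hμE : μ.real E ≤ C₂ * Z ^ (-(s / 2)) := by
    have h1 : μ.real E ≤ ((J : ℝ) + 1) ^ n * (Y.card * (A * h ^ s)) := by
      calc μ.real E ≤ ∑ k ∈ AffineIFS.exponents n J, μ.real (⋃ e ∈ Y, B k e) :=
            measureReal_biUnion_finset_le _ _
        _ ≤ ∑ k ∈ AffineIFS.exponents n J, ∑ e ∈ Y, μ.real (B k e) :=
            Finset.sum_le_sum fun k _ => measureReal_biUnion_finset_le _ _
        _ ≤ ∑ k ∈ AffineIFS.exponents n J, ∑ e ∈ Y, A * h ^ s :=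
            Finset.sum_le_sum fun k _ => Finset.sum_le_sum fun e _ => hsub _ _ hh0
        _ = _ := by
            simp only [Finset.sum_const, nsmul_eq_mul, AffineIFS.card_exponents]
            push_cast
            ring
    have h2 : ((J : ℝ) + 1) ^ n ≤ C₁ * ((S.lo⁻¹) ^ (s / 8) * Z ^ (s / 4)) := by
      refine (hcount J).trans ?_
      gcongr
      calc (S.hi⁻¹ ^ (s / 8)) ^ J = (S.hi⁻¹ ^ J) ^ (s / 8) := by
            rw [← Real.rpow_natCast, ← Real.rpow_natCast, ← Real.rpow_mul hw0.le,
              ← Real.rpow_mul hw0.le, mul_comm]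
        _ ≤ (S.lo⁻¹ * Z ^ 2) ^ (s / 8) := by gcongr
        _ = _ := by
            rw [Real.mul_rpow (by positivity) (by positivity), ← Real.rpow_natCast Z 2,
              ← Real.rpow_mul hZ0.le]
            congr 2
            push_cast
            ring
    have h3 : (Y.card : ℝ) ≤ C * (A ^ (s / 4) * Z ^ (s / 4)) := by
      rwa [Real.mul_rpow hA0.le hZ0.le] at hYc
    have h4 : h ^ s = h₁ ^ s * Z ^ (-s) := by
      rw [hh, Real.mul_rpow hh₁0.le (by positivity), Real.inv_rpow hZ0.le, Real.rpow_neg hZ0.le]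
    calc μ.real E ≤ (C₁ * ((S.lo⁻¹) ^ (s / 8) * Z ^ (s / 4))) *
          ((C * (A ^ (s / 4) * Z ^ (s / 4))) * (A * h ^ s)) := by
          refine h1.trans ?_
          gcongr
      _ = C₂ * (Z ^ (s / 4) * Z ^ (s / 4) * Z ^ (-s)) := by rw [h4, hC₂]; ring
      _ = C₂ * Z ^ (-(s / 2)) := by
          rw [← Real.rpow_add hZ0, ← Real.rpow_add hZ0]
          congr 2
          ring
  set Q := (A * Z) ^ (-δ) + 2 * Real.pi * (A * Z⁻¹) with hQ
  have hQ0 : 0 ≤ Q := by positivity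
  have hpiece : ∀ k σ v, |σ| = S.ratio k → MapsTo (fun x => σ * x + v) μ.support μ.support →
      S.lo * ρ ≤ |σ| → |σ| ≤ ρ →
      ‖∫ x, expNeg (ξ * F (σ * x + v)) ∂μ‖ ≤ Q + μ.real ((fun x => σ * x + v) ⁻¹' E) := by
    intro k σ v hσ hmaps hσ1 hσ2
    have hIcc : ∀ x ∈ μ.support, σ * x + v ∈ Icc (0 : ℝ) 1 := fun x hx => hμ.supp (hmaps hx)
    have hdist : ∀ x ∈ μ.support, |σ * (x - x₀)| ≤ ρ := fun x hx => by
      have h1 := hμ.supp hx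
      have h2 := hμ.supp hx₀
      have h3 : |x - x₀| ≤ 1 := by
        rw [abs_le]
        constructor <;> linarith [h1.1, h1.2, h2.1, h2.2]
      rw [abs_mul]
      calc |σ| * |x - x₀| ≤ ρ * 1 := mul_le_mul hσ2 h3 (abs_nonneg _) hρ.le
        _ = ρ := mul_one _
    set d := D (σ * x₀ + v) with hd
    have hd1 : |d| ≤ A := hDA _ (hIcc x₀ hx₀)
    have hlin := hμ.norm_integral_expNeg_le_of_taylor hF (ξ := ξ) (s := σ) (v := v) (x₀ := x₀)
      (d := d) (e := A * ρ ^ 2) fun x hx => by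
        have h1 := hFT _ (hIcc x₀ hx₀) _ (hIcc x hx)
        rw [show σ * x + v - (σ * x₀ + v) = σ * (x - x₀) by ring] at h1
        refine h1.trans ?_
        rw [← sq_abs (σ * (x - x₀))]
        have := hdist x hx
        gcongr
    have herr : |ξ| * (A * ρ ^ 2) = A * Z⁻¹ := by
      rw [hξ, hρ_def]
      field_simp
    rw [herr] at hlin
    -- Either the linearized integral is small, or the whole piece lies in `E`; then its preimage
    -- has mass one and the trivial bound suffices.
    rcases le_or_gt ((A * Z) ^ (-δ)) ‖fourierTransform μ (ξ * |σ| * d)‖ with hbig | hsmall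
    · have hfreq : |ξ * |σ| * d| ≤ A * Z := by
        rw [abs_mul, abs_mul, abs_abs, hξ]
        calc Z ^ 3 * |σ| * |d| ≤ Z ^ 3 * ρ * A := by gcongr
          _ = A * Z := by rw [hρ_def]; field_simp
      obtain ⟨e, he, hde⟩ := hY _ hfreq hbig
      have hσ0 : 0 < |σ| := by rw [hσ]; exact S.ratio_pos k
      have hk : k ∈ AffineIFS.exponents n J := by
        rw [AffineIFS.mem_exponents]
        intro i
        have h1 : S.lo * ρ ≤ S.hi ^ k i := by
          refine hσ1.trans (hσ.le.trans ((S.ratio_le_hi_pow k).trans ?_))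
          exact pow_le_pow_of_le_one S.hi_pos.le S.hi_lt_one.le
            (Finset.single_le_sum (fun _ _ => Nat.zero_le _) (Finset.mem_univ i))
        have h2 : S.hi⁻¹ ^ k i ≤ S.lo⁻¹ * Z ^ 2 := by
          rw [inv_pow]
          refine (inv_anti₀ (by positivity) h1).trans (le_of_eq ?_)
          rw [mul_inv, hρ_def, inv_inv]
        exact Nat.lt_succ_iff.1 ((pow_lt_pow_iff_right₀ hw).1 (h2.trans_lt hJ2))
      have hone : μ.real ((fun x => σ * x + v) ⁻¹' E) = 1 := by
        refine measureReal_eq_one hμ fun x hx => ?_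
        refine mem_iUnion₂.2 ⟨k, hk, mem_iUnion₂.2 ⟨e, he, hIcc x hx, ?_⟩⟩
        rw [← hσ]
        have h1 : |d - e / (ξ * |σ|)| ≤ C / S.lo * Z⁻¹ := by
          have h2 : d - e / (ξ * |σ|) = (ξ * |σ| * d - e) / (ξ * |σ|) := by field_simp
          rw [h2, abs_div, abs_mul, abs_abs, hξ]
          calc |ξ * |σ| * d - e| / (Z ^ 3 * |σ|) ≤ C / (Z ^ 3 * (S.lo * ρ)) := by gcongr
            _ = C / S.lo * Z⁻¹ := by rw [hρ_def]; field_simp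
        have h3 : |D (σ * x + v) - d| ≤ A * Z⁻¹ := by
          refine (hDL _ (hIcc x hx) _ (hIcc x₀ hx₀)).trans ?_
          rw [show σ * x + v - (σ * x₀ + v) = σ * (x - x₀) by ring]
          refine mul_le_mul_of_nonneg_left ((hdist x hx).trans ?_) hA0.le
          rw [hρ_def]
          exact inv_anti₀ hZ0 (by nlinarith)
        calc |D (σ * x + v) - e / (ξ * |σ|)| ≤ |D (σ * x + v) - d| + |d - e / (ξ * |σ|)| :=
              abs_sub_le _ _ _
          _ ≤ A * Z⁻¹ + C / S.lo * Z⁻¹ := add_le_add h3 h1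
          _ = h := by rw [hh, hh₁]; ring
      rw [hone]
      have : ‖∫ x, expNeg (ξ * F (σ * x + v)) ∂μ‖ ≤ 1 := by
        refine (norm_integral_le_integral_norm _).trans ?_
        simp [norm_expNeg]
      linarith
    · have : 0 ≤ μ.real ((fun x => σ * x + v) ⁻¹' E) := measureReal_nonneg
      rw [hQ]
      linarith
  obtain ⟨N, hN⟩ := exists_pow_lt_of_lt_one hρ S.hi_lt_one
  have hmain := hμ.norm_integral_le_of_stopped (G := fun x => expNeg (ξ * F x))
    (continuous_expNeg.measurable.comp (hF.const_mul ξ)) (fun x => (norm_expNeg _).le) hE hpiece N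
    0 1 0 (by simp [S.ratio_zero]) (fun x hx => by simpa using hx)
    (by rw [abs_one]; nlinarith) (by rw [abs_one, one_mul]; exact hN.le)
  simp only [one_mul, add_zero, preimage_id'] at hmain
  have hpow : ∀ e, η ≤ e → Z ^ (-e) ≤ Z ^ (-η) := fun e he =>
    Real.rpow_le_rpow_of_exponent_le hZ (by linarith)
  have hQ1 : (A * Z) ^ (-δ) ≤ Z ^ (-η) := by
    refine le_trans ?_ (hpow δ ((min_le_left _ _).trans (min_le_left _ _)))
    exact Real.rpow_le_rpow_of_nonpos hZ0 (by nlinarith) (by linarith)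
  have hQ2 : Z⁻¹ ≤ Z ^ (-η) := by
    rw [← Real.rpow_neg_one]
    exact hpow 1 ((min_le_left _ _).trans (min_le_right _ _))
  calc ‖∫ x, expNeg (ξ * F x) ∂μ‖ ≤ Q + C₂ * Z ^ (-(s / 2)) := by linarith
    _ ≤ (Z ^ (-η) + 2 * Real.pi * (A * Z ^ (-η))) + C₂ * Z ^ (-η) := by
        rw [hQ]
        have := hpow (s / 2) (min_le_right _ _)
        have := Real.pi_pos
        have : 0 < C₂ := by positivity
        gcongr
    _ = _ := by ring

end IsCarriedStationary

/-! ### Analytic extension past the endpoints. -/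

open Topology Filter

/-- Analyticity within `[0, 1]` says nothing outside it, whereas `deriv` at the endpoints needs full
neighbourhoods. The local analytic extensions at 0 and 1 are glued on. -/
lemma exists_analyticOnNhd_Icc {F : ℝ → ℝ} (hF : AnalyticOn ℝ F (Icc 0 1)) :
    ∃ G : ℝ → ℝ, EqOn F G (Icc 0 1) ∧ AnalyticOnNhd ℝ G (Icc 0 1) := by
  have h0 : (0 : ℝ) ∈ Icc (0 : ℝ) 1 := ⟨le_rfl, zero_le_one⟩
  have h1 : (1 : ℝ) ∈ Icc (0 : ℝ) 1 := ⟨zero_le_one, le_rfl⟩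
  obtain ⟨g₀, -, hg₀, ha₀⟩ := (hF 0 h0).exists_analyticAt
  obtain ⟨g₁, -, hg₁, ha₁⟩ := (hF 1 h1).exists_analyticAt
  rw [insert_eq_of_mem h0] at hg₀
  rw [insert_eq_of_mem h1] at hg₁
  set G : ℝ → ℝ := fun x => if x < 0 then g₀ x else if x ≤ 1 then F x else g₁ x with hG
  have hGF : ∀ x ∈ Icc (0 : ℝ) 1, G x = F x := fun x hx => by
    simp [hG, not_lt.2 hx.1, hx.2]
  refine ⟨G, fun x hx => (hGF x hx).symm, fun x hx => ?_⟩
  rcases eq_or_lt_of_le hx.1 with rfl | hx0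
  · refine ha₀.congr ?_
    filter_upwards [Iio_mem_nhds (zero_lt_one (α := ℝ))] with y hy
    rcases lt_or_ge y 0 with h | h
    · simp [hG, h]
    · rw [hGF y ⟨h, le_of_lt hy⟩, hg₀ ⟨h, le_of_lt hy⟩]
  rcases eq_or_lt_of_le hx.2 with rfl | hx1
  · refine ha₁.congr ?_
    filter_upwards [Ioi_mem_nhds (zero_lt_one (α := ℝ))] with y hy
    rcases lt_or_ge 1 y with h | h
    · simp [hG, not_lt.2 (zero_le_one.trans h.le), not_le.2 h]
    · rw [hGF y ⟨le_of_lt hy, h⟩, hg₁ ⟨le_of_lt hy, h⟩]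
  · have hnhds : Icc (0 : ℝ) 1 ∈ 𝓝 x := Icc_mem_nhds hx0 hx1
    obtain ⟨g, -, hg, ha⟩ := (hF x hx).exists_analyticAt
    rw [insert_eq_of_mem hx] at hg
    refine ha.congr ?_
    filter_upwards [hnhds] with y hy
    rw [hGF y hy, hg hy]

/-! ### Sublevel sets of the derivative, and Taylor bounds. -/

/-- Derivatives bounded below by `a * (x - x₀) ^ k` to the right of `x₀` force expansion. -/
lemma mul_pow_le_sub_of_deriv {D d : ℝ → ℝ} {x₀ δ a : ℝ} {k : ℕ} (ha : 0 ≤ a)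
    (hd : ∀ x ∈ Icc x₀ (x₀ + δ), HasDerivAt D (d x) x)
    (hda : ∀ x ∈ Icc x₀ (x₀ + δ), a * (x - x₀) ^ k ≤ d x) {x y : ℝ}
    (hx : x ∈ Icc x₀ (x₀ + δ)) (hy : y ∈ Icc x₀ (x₀ + δ)) (hxy : x ≤ y) :
    a / (k + 1) * (y - x) ^ (k + 1) ≤ D y - D x := by
  have hk : (0 : ℝ) < k + 1 := by positivity
  have hder : ∀ z ∈ Icc x₀ (x₀ + δ),
      HasDerivAt (fun z => D z - a / (k + 1) * (z - x₀) ^ (k + 1)) (d z - a * (z - x₀) ^ k) z := by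
    intro z hz
    have h1 := (((hasDerivAt_id z).sub_const x₀).pow (k + 1)).const_mul (a / (k + 1))
    have h2 := (hd z hz).sub h1
    refine h2.congr_deriv ?_
    simp only [id, Nat.add_sub_cancel, mul_one]
    push_cast
    field_simp
  have hmono := monotoneOn_of_hasDerivWithinAt_nonneg (convex_Icc x₀ (x₀ + δ))
    (fun z hz => (hder z hz).continuousAt.continuousWithinAt)
    (fun z hz => (hder z (interior_subset hz)).hasDerivWithinAt)
    (fun z hz => sub_nonneg.2 (hda z (interior_subset hz))) hx hy hxy
  simp only at hmono
  have hpow : (y - x) ^ (k + 1) + (x - x₀) ^ (k + 1) ≤ (y - x₀) ^ (k + 1) := by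
    have := pow_add_pow_le (sub_nonneg.2 hxy) (sub_nonneg.2 hx.1) (Nat.succ_ne_zero k)
    simpa using this
  have hak : 0 ≤ a / (k + 1) := by positivity
  nlinarith [mul_le_mul_of_nonneg_left hpow hak]

/-- `E` carries little `μ`-mass of the sublevel sets of `D`, uniformly in the level. -/
def HasSublevelBound (μ : Measure ℝ) (D : ℝ → ℝ) (E : Set ℝ) : Prop :=
  ∃ A s : ℝ, 0 < A ∧ 0 < s ∧ ∀ c h, 0 < h → μ.real {x | x ∈ E ∧ |D x - c| ≤ h} ≤ A * h ^ s

lemma HasSublevelBound.mono {μ : Measure ℝ} [IsProbabilityMeasure μ] {D : ℝ → ℝ} {E E' : Set ℝ}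
    (hE : E ⊆ E') (h : HasSublevelBound μ D E') : HasSublevelBound μ D E := by
  obtain ⟨A, s, hA, hs, hb⟩ := h
  exact ⟨A, s, hA, hs, fun c h hh =>
    (measureReal_mono (show {x | x ∈ E ∧ |D x - c| ≤ h} ⊆ {x | x ∈ E' ∧ |D x - c| ≤ h} from
      fun _ hx => ⟨hE hx.1, hx.2⟩)).trans (hb c h hh)⟩

lemma HasSublevelBound.union {μ : Measure ℝ} [IsProbabilityMeasure μ] {D : ℝ → ℝ} {E E' : Set ℝ}
    (h : HasSublevelBound μ D E) (h' : HasSublevelBound μ D E') :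
    HasSublevelBound μ D (E ∪ E') := by
  obtain ⟨A, s, hA, hs, hb⟩ := h
  obtain ⟨A', s', hA', hs', hb'⟩ := h'
  refine ⟨A + A' + 1, min s s', by positivity, lt_min hs hs', fun c h hh => ?_⟩
  have hm : 0 < h ^ min s s' := Real.rpow_pos_of_pos hh _
  -- The smaller exponent gives the weaker bound only for `h < 1`; for `h ≥ 1` the added constant 1
  -- covers the total mass.
  rcases le_or_gt 1 h with h1 | h1
  · have h2 : 1 ≤ h ^ min s s' := Real.one_le_rpow h1 (lt_min hs hs').le
    have h3 : μ.real {x | x ∈ E ∪ E' ∧ |D x - c| ≤ h} ≤ 1 := measureReal_le_one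
    nlinarith
  · have h2 : {x | x ∈ E ∪ E' ∧ |D x - c| ≤ h} =
        {x | x ∈ E ∧ |D x - c| ≤ h} ∪ {x | x ∈ E' ∧ |D x - c| ≤ h} := by
      ext x
      simp only [mem_union, mem_ofPred_eq, or_and_right]
    have h3 : h ^ s ≤ h ^ min s s' :=
      Real.rpow_le_rpow_of_exponent_ge hh h1.le (min_le_left _ _)
    have h4 : h ^ s' ≤ h ^ min s s' :=
      Real.rpow_le_rpow_of_exponent_ge hh h1.le (min_le_right _ _)
    rw [h2]
    refine (measureReal_union_le _ _).trans ?_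
    have := hb c h hh
    have := hb' c h hh
    nlinarith

/-- By expansion a sublevel set has diameter at most `(2 * h / a) ^ (1 / (k + 1))`, so a ball around
any of its points contains it and the Hölder bound applies. -/
lemma hasSublevelBound_of_expanding {μ : Measure ℝ} [IsProbabilityMeasure μ] {C s : ℝ} (hC : 0 < C)
    (hs : 0 < s) (hμ : ∀ x ρ, 0 < ρ → μ.real (Metric.closedBall x ρ) ≤ C * ρ ^ s)
    {D : ℝ → ℝ} {E : Set ℝ} {a : ℝ} {k : ℕ} (ha : 0 < a)
    (hD : ∀ x ∈ E, ∀ y ∈ E, x ≤ y → a * (y - x) ^ (k + 1) ≤ |D y - D x|) :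
    HasSublevelBound μ D E := by
  have hk : (0 : ℝ) < ((k + 1 : ℕ) : ℝ)⁻¹ := by positivity
  refine ⟨C * ((2 / a) ^ ((k + 1 : ℕ) : ℝ)⁻¹) ^ s, ((k + 1 : ℕ) : ℝ)⁻¹ * s, by positivity,
    by positivity, fun c h hh => ?_⟩
  have hrw : C * ((2 / a) ^ ((k + 1 : ℕ) : ℝ)⁻¹) ^ s * h ^ (((k + 1 : ℕ) : ℝ)⁻¹ * s) =
      C * ((2 / a * h) ^ ((k + 1 : ℕ) : ℝ)⁻¹) ^ s := by
    rw [Real.mul_rpow (by positivity) hh.le, Real.mul_rpow (by positivity) (by positivity),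
      ← Real.rpow_mul hh.le, mul_assoc]
  rw [hrw]
  rcases eq_empty_or_nonempty {x | x ∈ E ∧ |D x - c| ≤ h} with hempty | ⟨x, hx⟩
  · rw [hempty, measureReal_empty]
    positivity
  refine le_trans (measureReal_mono ?_) (hμ x _ (by positivity))
  have key : ∀ u v, u ∈ E → v ∈ E → u ≤ v → |D u - c| ≤ h → |D v - c| ≤ h →
      v - u ≤ (2 / a * h) ^ ((k + 1 : ℕ) : ℝ)⁻¹ := by
    intro u v hu hv huv h1 h2
    have h3 := hD u hu v hv huv
    have h4 : |D v - D u| ≤ 2 * h := by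
      have := abs_sub_le (D v) c (D u)
      rw [abs_sub_comm c] at this
      linarith
    have h5 : (v - u) ^ (k + 1) ≤ 2 / a * h := by
      rw [div_mul_eq_mul_div, le_div_iff₀ ha]
      linarith
    rw [← Real.pow_rpow_inv_natCast (sub_nonneg.2 huv) (Nat.succ_ne_zero k)]
    exact Real.rpow_le_rpow (pow_nonneg (sub_nonneg.2 huv) _) h5 hk.le
  intro y hy
  rw [Metric.mem_closedBall, Real.dist_eq]
  rcases le_total x y with hxy | hxy
  · rw [abs_of_nonneg (sub_nonneg.2 hxy)]
    exact key x y hx.1 hy.1 hxy hx.2 hy.2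
  · rw [abs_of_nonpos (sub_nonpos.2 hxy), neg_sub]
    exact key y x hy.1 hx.1 hxy hy.2 hx.2

lemma expanding_right_of_deriv {D d : ℝ → ℝ} {x₀ δ a : ℝ} {k : ℕ} (ha : 0 ≤ a)
    (hd : ∀ x ∈ Icc x₀ (x₀ + δ), HasDerivAt D (d x) x)
    (hda : (∀ x ∈ Icc x₀ (x₀ + δ), a * (x - x₀) ^ k ≤ d x) ∨
      ∀ x ∈ Icc x₀ (x₀ + δ), a * (x - x₀) ^ k ≤ -d x) :
    ∀ x ∈ Icc x₀ (x₀ + δ), ∀ y ∈ Icc x₀ (x₀ + δ), x ≤ y →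
      a / (k + 1) * (y - x) ^ (k + 1) ≤ |D y - D x| := by
  intro x hx y hy hxy
  rcases hda with hda | hda
  · exact (mul_pow_le_sub_of_deriv ha hd hda hx hy hxy).trans (le_abs_self _)
  · have := mul_pow_le_sub_of_deriv (D := fun z => -D z) ha (fun z hz => (hd z hz).neg) hda hx hy hxy
    refine this.trans (le_trans (le_of_eq ?_) (neg_le_abs _))
    ring

/-- A function whose derivative has a zero of finite order at `x₀` expands on either side. -/
lemma exists_expanding_of_factor {D d g : ℝ → ℝ} {x₀ : ℝ} {k : ℕ}
    (hd : ∀ᶠ x in 𝓝 x₀, HasDerivAt D (d x) x) (hg : ContinuousAt g x₀) (hg0 : g x₀ ≠ 0)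
    (hdg : ∀ᶠ x in 𝓝 x₀, d x = (x - x₀) ^ k * g x) :
    ∃ δ a : ℝ, 0 < δ ∧ 0 < a ∧ ∀ x ∈ Icc x₀ (x₀ + δ), ∀ y ∈ Icc x₀ (x₀ + δ), x ≤ y →
      a * (y - x) ^ (k + 1) ≤ |D y - D x| := by
  have habs : 0 < |g x₀| / 2 := by positivity
  have hnear : ∀ᶠ x in 𝓝 x₀, |g x - g x₀| < |g x₀| / 2 := by
    have := Metric.tendsto_nhds.1 hg _ habs
    simpa only [Real.dist_eq] using this
  obtain ⟨ε, hε, hball⟩ := Metric.eventually_nhds_iff_ball.1 (hd.and (hdg.and hnear))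
  have hsub : ∀ x ∈ Icc x₀ (x₀ + ε / 2), x ∈ Metric.ball x₀ ε := fun x hx => by
    rw [Metric.mem_ball, Real.dist_eq, abs_of_nonneg (sub_nonneg.2 hx.1)]
    linarith [hx.2]
  refine ⟨ε / 2, |g x₀| / 2 / (k + 1), by positivity, by positivity, ?_⟩
  refine expanding_right_of_deriv habs.le (fun x hx => (hball x (hsub x hx)).1) ?_
  rcases lt_or_gt_of_ne hg0 with h | h
  · right
    intro x hx
    obtain ⟨-, h1, h2⟩ := hball x (hsub x hx)
    rw [abs_of_neg h] at h2 ⊢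
    have h3 := (abs_lt.1 h2).2
    have h4 : 0 ≤ (x - x₀) ^ k := pow_nonneg (sub_nonneg.2 hx.1) _
    rw [h1]
    nlinarith
  · left
    intro x hx
    obtain ⟨-, h1, h2⟩ := hball x (hsub x hx)
    rw [abs_of_pos h] at h2 ⊢
    have h3 := (abs_lt.1 h2).1
    have h4 : 0 ≤ (x - x₀) ^ k := pow_nonneg (sub_nonneg.2 hx.1) _
    rw [h1]
    nlinarith

/-- Sublevel bound near a point where the derivative has a zero of finite order. -/
lemma exists_nhds_hasSublevelBound {μ : Measure ℝ} [IsProbabilityMeasure μ] {C s : ℝ} (hC : 0 < C)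
    (hs : 0 < s) (hμ : ∀ x ρ, 0 < ρ → μ.real (Metric.closedBall x ρ) ≤ C * ρ ^ s)
    {D : ℝ → ℝ} {x₀ : ℝ} (hD : AnalyticAt ℝ D x₀) (hne : ¬ ∀ᶠ x in 𝓝 x₀, deriv D x = 0) :
    ∃ U ∈ 𝓝 x₀, HasSublevelBound μ D U := by
  obtain ⟨k, g, hg, hg0, hdg⟩ := hD.deriv.exists_eventuallyEq_pow_smul_nonzero_iff.2 hne
  simp only [smul_eq_mul] at hdg
  have hd : ∀ᶠ x in 𝓝 x₀, HasDerivAt D (deriv D x) x :=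
    hD.eventually_analyticAt.mono fun x hx => hx.differentiableAt.hasDerivAt
  obtain ⟨δ₁, a₁, hδ₁, ha₁, hright⟩ := exists_expanding_of_factor hd hg.continuousAt hg0 hdg
  have hrefl : Tendsto (fun x : ℝ => 2 * x₀ - x) (𝓝 x₀) (𝓝 x₀) := by
    have : ContinuousAt (fun x : ℝ => 2 * x₀ - x) x₀ := by fun_prop
    simpa [ContinuousAt, two_mul] using this
  -- The left side is the right side of the reflection in `x₀`; the sign `(-1) ^ (k + 1)` comes from
  -- the chain rule and from `(x₀ - x) ^ k`.
  obtain ⟨δ₂, a₂, hδ₂, ha₂, hleft⟩ := exists_expanding_of_factor (D := fun x => D (2 * x₀ - x))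
    (d := fun x => -deriv D (2 * x₀ - x)) (g := fun x => (-1) ^ (k + 1) * g (2 * x₀ - x))
    (x₀ := x₀) (k := k)
    (by
      filter_upwards [hrefl.eventually hd] with x hx
      have := hx.comp x ((hasDerivAt_id x).const_sub (2 * x₀))
      rw [mul_neg, mul_one] at this
      exact this)
    (by
      have : Tendsto g (𝓝 x₀) (𝓝 (g x₀)) := hg.continuousAt
      have h2 := (this.comp hrefl).const_mul ((-1 : ℝ) ^ (k + 1))
      simpa [ContinuousAt, two_mul, Function.comp_def] using h2)
    (by simp [two_mul, hg0])
    (by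
      filter_upwards [hrefl.eventually hdg] with x hx
      rw [hx, show 2 * x₀ - x - x₀ = (-1) * (x - x₀) by ring, mul_pow]
      ring)
  have hL : HasSublevelBound μ D (Icc (x₀ - δ₂) x₀) := by
    refine hasSublevelBound_of_expanding hC hs hμ ha₂ (k := k) fun x hx y hy hxy => ?_
    have := hleft (2 * x₀ - y) ⟨by linarith [hy.2], by linarith [hy.1]⟩ (2 * x₀ - x)
      ⟨by linarith [hx.2], by linarith [hx.1]⟩ (by linarith)
    simp only [sub_sub_cancel] at this
    rw [abs_sub_comm]
    refine le_trans (le_of_eq ?_) this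
    congr 2
    ring
  have hR : HasSublevelBound μ D (Icc x₀ (x₀ + δ₁)) :=
    hasSublevelBound_of_expanding hC hs hμ ha₁ hright
  refine ⟨Icc (x₀ - δ₂) (x₀ + δ₁), Icc_mem_nhds (by linarith) (by linarith), ?_⟩
  rw [← Icc_union_Icc_eq_Icc (b := x₀) (by linarith) (by linarith)]
  exact hL.union hR

lemma isAffineOn_of_deriv_deriv_eq_zero {G : ℝ → ℝ} (hG : AnalyticOnNhd ℝ G (Icc 0 1))
    (h : ∀ x ∈ Icc (0 : ℝ) 1, deriv (deriv G) x = 0) : IsAffineOn G (Icc 0 1) := by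
  have hconst : ∀ x ∈ Icc (0 : ℝ) 1, deriv G x = deriv G 0 :=
    constant_of_has_deriv_right_zero hG.deriv.continuousOn fun x hx => by
      have hx' : x ∈ Icc (0 : ℝ) 1 := Ico_subset_Icc_self hx
      have := (hG.deriv x hx').differentiableAt.hasDerivAt
      rw [h x hx'] at this
      exact this.hasDerivWithinAt
  have hlin : ∀ x ∈ Icc (0 : ℝ) 1, G x - deriv G 0 * x = G 0 - deriv G 0 * 0 :=
    constant_of_has_deriv_right_zero (f := fun x => G x - deriv G 0 * x)
      (hG.continuousOn.sub (by fun_prop)) fun x hx => by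
      have hx' : x ∈ Icc (0 : ℝ) 1 := Ico_subset_Icc_self hx
      have h1 := ((hG x hx').differentiableAt.hasDerivAt).sub
        ((hasDerivAt_id x).const_mul (deriv G 0))
      rw [hconst x hx', mul_one, sub_self] at h1
      exact h1.hasDerivWithinAt
  exact ⟨deriv G 0, G 0, fun x hx => by linarith [hlin x hx]⟩

/-- If `G''` vanished near one point, the identity theorem would make it vanish on `[0, 1]` and `G`
would be affine. So the local bound holds everywhere, and compactness leaves finitely many
neighbourhoods. -/
lemma hasSublevelBound_deriv {μ : Measure ℝ} [IsProbabilityMeasure μ] {C s : ℝ} (hC : 0 < C)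
    (hs : 0 < s) (hμ : ∀ x ρ, 0 < ρ → μ.real (Metric.closedBall x ρ) ≤ C * ρ ^ s)
    {G : ℝ → ℝ} (hG : AnalyticOnNhd ℝ G (Icc 0 1)) (hna : ¬ IsAffineOn G (Icc 0 1)) :
    HasSublevelBound μ (deriv G) (Icc 0 1) := by
  refine isCompact_Icc.induction_on (p := HasSublevelBound μ (deriv G)) ?_
    (fun E E' hE h => h.mono hE) (fun E E' h h' => h.union h') fun x hx => ?_
  · exact ⟨1, 1, one_pos, one_pos, fun c h hh => by simpa using hh.le⟩
  · obtain ⟨U, hU, hb⟩ := exists_nhds_hasSublevelBound hC hs hμ (hG.deriv x hx) fun hzero =>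
      hna (isAffineOn_of_deriv_deriv_eq_zero hG
        (hG.deriv.deriv.eqOn_zero_of_preconnected_of_eventuallyEq_zero isPreconnected_Icc hx hzero))
    exact ⟨U, mem_nhdsWithin_of_mem_nhds hU, hb⟩

/-- Uniform first and second order bounds for an analytic function on `[0, 1]`. -/
lemma exists_taylor_bounds {G : ℝ → ℝ} (hG : AnalyticOnNhd ℝ G (Icc 0 1)) :
    ∃ A : ℝ, 0 < A ∧ (∀ x ∈ Icc (0 : ℝ) 1, |deriv G x| ≤ A) ∧
      (∀ x ∈ Icc (0 : ℝ) 1, ∀ y ∈ Icc (0 : ℝ) 1, |deriv G x - deriv G y| ≤ A * |x - y|) ∧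
      ∀ x ∈ Icc (0 : ℝ) 1, ∀ y ∈ Icc (0 : ℝ) 1,
        |G y - G x - deriv G x * (y - x)| ≤ A * (y - x) ^ 2 := by
  obtain ⟨A₁, hA₁⟩ := isCompact_Icc.exists_bound_of_continuousOn hG.deriv.continuousOn
  obtain ⟨A₂, hA₂⟩ := isCompact_Icc.exists_bound_of_continuousOn hG.deriv.deriv.continuousOn
  set A := max (max A₁ A₂) 1 with hA
  have hA1 : A₁ ≤ A := (le_max_left _ _).trans (le_max_left _ _)
  have hA2 : A₂ ≤ A := (le_max_right _ _).trans (le_max_left _ _)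
  have hA0 : 0 < A := lt_max_of_lt_right one_pos
  have hlip : ∀ x ∈ Icc (0 : ℝ) 1, ∀ y ∈ Icc (0 : ℝ) 1,
      |deriv G x - deriv G y| ≤ A * |x - y| := fun x hx y hy =>
    (convex_Icc (0 : ℝ) 1).norm_image_sub_le_of_norm_hasDerivWithin_le
      (fun z hz => (hG.deriv z hz).differentiableAt.hasDerivAt.hasDerivWithinAt)
      (fun z hz => (hA₂ z hz).trans hA2) hy hx
  refine ⟨A, hA0, fun x hx => (hA₁ x hx).trans hA1, hlip, fun x hx y hy => ?_⟩
  have hsub : uIcc x y ⊆ Icc 0 1 := uIcc_subset_Icc hx hy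
  have h1 := (convex_uIcc x y).norm_image_sub_le_of_norm_hasDerivWithin_le
    (f := fun z => G z - deriv G x * z) (f' := fun z => deriv G z - deriv G x) (C := A * |y - x|)
    (fun z hz => by
      have h2 := ((hG z (hsub hz)).differentiableAt.hasDerivAt).sub
        ((hasDerivAt_id z).const_mul (deriv G x))
      rw [mul_one] at h2
      exact h2.hasDerivWithinAt)
    (fun z hz => by
      rw [Real.norm_eq_abs]
      refine (hlip z (hsub hz) x hx).trans ?_
      have := abs_sub_left_of_mem_uIcc hz
      gcongr)
    left_mem_uIcc right_mem_uIcc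
  simp only [Real.norm_eq_abs] at h1
  rw [mul_assoc, abs_mul_abs_self, ← sq] at h1
  refine le_trans (le_of_eq ?_) h1
  congr 1
  ring

/-! ### Reduction to affine systems, and the conclusion. -/

lemma IsContractingSimilarity.exists_affine {φ : ℝ → ℝ} (h : IsContractingSimilarity φ) :
    ∃ r t : ℝ, 0 < |r| ∧ |r| < 1 ∧ ∀ x, φ x = r * x + t := by
  obtain ⟨ρ, hρ0, hρ1, hφ⟩ := h
  have hsq : ∀ x y, (φ x - φ y) ^ 2 = ρ ^ 2 * (x - y) ^ 2 := fun x y => by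
    rw [← sq_abs, hφ, mul_pow, sq_abs]
  have habs : |φ 1 - φ 0| = ρ := by simpa using hφ 1 0
  refine ⟨φ 1 - φ 0, φ 0, habs ▸ hρ0, habs ▸ hρ1, fun x => ?_⟩
  have hne : φ 1 - φ 0 ≠ 0 := abs_pos.1 (habs ▸ hρ0)
  have h1 := hsq x 0
  have h2 := hsq x 1
  have h3 := hsq 1 0
  -- Polarization: the squared distances among the images of `x`, 0 and 1 determine the product of
  -- `φ x - φ 0` and `φ 1 - φ 0`.
  have : (φ 1 - φ 0) * (φ x - ((φ 1 - φ 0) * x + φ 0)) = 0 := by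
    linear_combination (1 / 2) * h1 - (1 / 2) * h2 + (1 / 2 - x) * h3
  linarith [(mul_eq_zero.1 this).resolve_left hne]

lemma AffineIFS.toMap_fixedPoint {n : ℕ} (S : AffineIFS n) (a : Fin n) :
    S.toMap a (S.fixedPoint a) = S.fixedPoint a := by
  simpa using S.toMap_iterate a 1 (S.fixedPoint a)

/-- Vanishing means `t a * (1 - r b) = t b * (1 - r a)`, that is, equal fixed points. -/
lemma AffineIFS.commutator_ne_zero {n : ℕ} (S : AffineIFS n) {a b : Fin n}
    (hab : S.fixedPoint a ≠ S.fixedPoint b) :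
    S.t a + S.r a * S.t b - (S.t b + S.r b * S.t a) ≠ 0 := fun h =>
  hab ((div_eq_div_iff (S.one_sub_r_ne a) (S.one_sub_r_ne b)).2 (by linarith))

lemma IsSelfSimilarMeasure.exists_affineIFS {μ : Measure ℝ} (hμ : IsSelfSimilarMeasure μ)
    (hsupp : μ.support ⊆ Icc 0 1) :
    ∃ (n : ℕ) (S : AffineIFS n) (a b : Fin n), IsCarriedStationary S μ ∧
      S.fixedPoint a ≠ S.fixedPoint b := by
  obtain ⟨n, φ, p, hφ, hfix, hp, hsum, hprob, hst⟩ := hμ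
  choose r t hr0 hr1 hrt using fun a => (hφ a).exists_affine
  have hne : Nonempty (Fin n) := by
    by_contra h
    rw [not_nonempty_iff] at h
    simp at hsum
  obtain ⟨a₀, ha₀⟩ := Finite.exists_min fun a => |r a|
  obtain ⟨a₁, ha₁⟩ := Finite.exists_max fun a => |r a|
  let S : AffineIFS n := ⟨r, t, p, |r a₀|, |r a₁|, hr0 a₀, hr1 a₁, ha₀, ha₁, hp, hsum⟩
  have hS : ∀ a, S.toMap a = φ a := fun a => funext fun x => (hrt a x).symm
  have hex : ∃ a b, S.fixedPoint a ≠ S.fixedPoint b := by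
    by_contra! hcon
    refine hfix ⟨S.fixedPoint a₀, fun a => ?_⟩
    rw [← hS, hcon a₀ a, S.toMap_fixedPoint]
  obtain ⟨a, b, hab⟩ := hex
  refine ⟨n, S, a, b, ⟨hprob, ?_, hsupp⟩, hab⟩
  simp only [hS]
  exact hst

lemma hasPolynomialFourierDecay_of_cube {ν : Measure ℝ} [IsProbabilityMeasure ν] {C η : ℝ}
    (hC : 0 < C) (hη : 0 < η) (h : ∀ ξ Z : ℝ, 1 ≤ Z → |ξ| = Z ^ 3 →
      ‖fourierTransform ν ξ‖ ≤ C * Z ^ (-η)) : HasPolynomialFourierDecay ν := by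
  refine ⟨C + 1, η / 3, by positivity, by positivity, fun ξ hξ => ?_⟩
  have hξ0 : 0 < |ξ| := abs_pos.2 hξ
  have hpow : 0 < |ξ| ^ (-(η / 3)) := Real.rpow_pos_of_pos hξ0 _
  -- For `|ξ| < 1` the negative power is at least 1 and the trivial bound is enough.
  rcases le_or_gt 1 |ξ| with h1 | h1
  · have h2 := h ξ (|ξ| ^ (1 / 3 : ℝ)) (Real.one_le_rpow h1 (by norm_num)) (by
      rw [← Real.rpow_natCast, ← Real.rpow_mul hξ0.le]
      norm_num)
    rw [← Real.rpow_mul hξ0.le, show (1 / 3 : ℝ) * -η = -(η / 3) by ring] at h2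
    linarith
  · have h2 : 1 ≤ |ξ| ^ (-(η / 3)) :=
      Real.one_le_rpow_of_pos_of_le_one_of_nonpos hξ0 h1.le (by linarith)
    have h3 := norm_fourierTransform_le_one ν ξ
    nlinarith

end SelfSimilarDecay
end

theorem mainTheorem2 (μ : MeasureTheory.Measure ℝ)
    (hμ : SelfSimilarDecay.IsSelfSimilarMeasure μ)
    (hsupp : μ.support ⊆ Set.Icc (0 : ℝ) 1)
    (F : ℝ → ℝ) (hF : AnalyticOn ℝ F (Set.Icc (0 : ℝ) 1))
    (hna : ¬ SelfSimilarDecay.IsAffineOn F (Set.Icc (0 : ℝ) 1)) :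
    SelfSimilarDecay.HasPolynomialFourierDecay (μ.map F) := by
  open SelfSimilarDecay in
  obtain ⟨n, S, a, b, hst, hab⟩ := hμ.exists_affineIFS hsupp
  have := hst.prob
  have hFm := aemeasurable_of_analyticOn hsupp hF
  have : IsProbabilityMeasure (μ.map F) := Measure.isProbabilityMeasure_map hFm
  obtain ⟨G, hFG, hG⟩ := exists_analyticOnNhd_Icc hF
  have hGna : ¬ IsAffineOn G (Icc 0 1) := fun ⟨α, β, h⟩ =>
    hna ⟨α, β, fun x hx => (hFG hx).trans (h x hx)⟩
  obtain ⟨C₀, s₀, hC₀, hs₀, hfrost⟩ := hst.exists_frostman hab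
  obtain ⟨A₁, s, hA₁, hs, hsub⟩ := hasSublevelBound_deriv hC₀ hs₀ hfrost hG hGna
  obtain ⟨A₂, hA₂, hbound, hlip, htaylor⟩ := exists_taylor_bounds hG
  have hle₁ : A₁ ≤ A₁ + A₂ + 1 := by linarith
  have hle₂ : A₂ ≤ A₁ + A₂ + 1 := by linarith
  have hind : ∀ x ∈ Icc (0 : ℝ) 1, (Icc (0 : ℝ) 1).indicator G x = G x := fun x hx =>
    indicator_of_mem hx G
  -- The indicator supplies a globally measurable phase; `G` itself is controlled only near `[0,
  -- 1]`.
  have hGm : Measurable ((Icc (0 : ℝ) 1).indicator G) := by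
    classical
    rw [← piecewise_eq_indicator]
    exact hG.continuousOn.measurable_piecewise continuousOn_const measurableSet_Icc
  obtain ⟨C, η, hC, hη, hdecay⟩ := hst.exists_decay_of_sublevel (S.commutator_ne_zero hab)
    (F := (Icc (0 : ℝ) 1).indicator G) (D := deriv G) (A := A₁ + A₂ + 1) hGm (measurable_deriv G)
    (by linarith) hs (fun x hx => (hbound x hx).trans hle₂)
    (fun x hx y hy => (hlip x hx y hy).trans (mul_le_mul_of_nonneg_right hle₂ (abs_nonneg _)))
    (fun x hx y hy => by
      rw [hind x hx, hind y hy]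
      exact (htaylor x hx y hy).trans (mul_le_mul_of_nonneg_right hle₂ (sq_nonneg _)))
    (fun c h hh => (hsub c h hh).trans
      (mul_le_mul_of_nonneg_right hle₁ (Real.rpow_pos_of_pos hh _).le))
  refine hasPolynomialFourierDecay_of_cube hC hη fun ξ Z hZ hξ => ?_
  have heq : fourierTransform (μ.map F) ξ =
      ∫ x, expNeg (ξ * (Icc (0 : ℝ) 1).indicator G x) ∂μ := by
    rw [fourierTransform_eq, integral_map hFm (f := fun x => expNeg (ξ * x))
      (continuous_expNeg.comp (continuous_const.mul continuous_id)).aestronglyMeasurable]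
    refine integral_congr_ae ?_
    filter_upwards [Measure.support_mem_ae (μ := μ)] with x hx
    rw [hind x (hsupp hx), hFG (hsupp hx)]
  rw [heq]
  exact hdecay ξ Z hZ hξ
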